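/- Let $n\ge 1$ and let $\mathbb{CP}^n$ be the complex projective space of lines in $\mathbb C^{n+1}$, with its standard complex structure. Then $\mathbb{CP}^n$ admits a unique holomorphic projective connection, namely the standard flat one. In detail: (a) Let $n\ge 2$. A holomorphic projective connection on a complex manifold $M$ of dimension $n\ge 2$ is a collection $(U_i,\nabla_i)_{i\in I}$, where the $U_i$ are open subsets covering $M$ and $\nabla_i$ is a torsionfree holomorphic affine connection on $U_i$ (a holomorphic connection on $TU_i$), such that for all $i,j$ the connections $\nabla_i$ and $\nabla_j$ are projectively equivalent on $U_i\cap U_j$, that is, they have there the same non-parametrized holomorphic geodesics (immersed holomorphic curves $\gamma$ with $\nabla_{\gamma'}\gamma'$ everywhere proportional to $\gamma'$). Two holomorphic projective connections are projectively equivalent if their union is again a holomorphic projective connection, and a holomorphic projective connection is flat if it is projectively equivalent to one all of whose members $\nabla_i$ have zero curvature. For $0\le i\le n$ let $U_i=\{[v_0:\dots:v_n] : v_i\neq 0\}$, and let $\nabla_i$ be the connection on $U_i$ that corresponds to the standard connection of $\mathbb C^n$ under the affine coordinates $(v_k/v_i)_{k\ne i}$. Then $(U_i,\nabla_i)_{0\le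 i\le n}$ is a holomorphic projective connection on $\mathbb{CP}^n$, it is flat, and every holomorphic projective connection on $\mathbb{CP}^n$ is projectively equivalent to it. (b) Let $n=1$. A holomorphic projective connection on a Riemann surface $M$ is a holomorphic projective structure, that is, a collection of holomorphic embeddings $\phi_i:U_i\to\mathbb{CP}^1$ of open subsets covering $M$ such that on each connected component of $U_i\cap U_j$ one has $\phi_i=g\circ\phi_j$ for some $g\in\mathrm{PGL}(2,\mathbb C)$; two of them are equivalent if their union is again a holomorphic projective structure. The identity map of $\mathbb{CP}^1$ is a holomorphic projective structure on $\mathbb{CP}^1$, and every holomorphic projective structure on $\mathbb{CP}^1$ is equivalent to it. -/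

import Mathlib

open scoped Manifold ContDiff Topology Bundle LinearAlgebra.Projectivization MatrixGroups

noncomputable section

/-! ### Complex projective space as a complex manifold -/

/-- Complex projective space: the space of lines in `ℂ^(n+1)`. -/
abbrev CP (n : ℕ) : Type := ℙ ℂ (Fin (n + 1) → ℂ)

namespace CP

/-- The quotient topology from `ℂ^(n+1) ∖ {0}`. -/
instance instTopologicalSpace (n : ℕ) : TopologicalSpace (CP n) :=
  inferInstanceAs
    (TopologicalSpace (Quotient (projectivizationSetoid ℂ (Fin (n + 1) → ℂ))))

variable {n : ℕ}

lemma isQuotientMap_mk' :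
    Topology.IsQuotientMap
      (Projectivization.mk' ℂ : { v : Fin (n + 1) → ℂ // v ≠ 0 } → CP n) :=
  isQuotientMap_quot_mk

/-- The affine coordinates `[v₀ : … : vₙ] ↦ (v_k / v_i)_{k ≠ i}`. -/
def affineCoord (i : Fin (n + 1)) (p : CP n) : Fin n → ℂ :=
  Projectivization.lift
    (fun (v : { v : Fin (n + 1) → ℂ // v ≠ 0 }) (k : Fin n) => v.1 (i.succAbove k) / v.1 i)
    (by
      rintro ⟨a, ha⟩ ⟨b, hb⟩ t h
      simp only at h
      subst h
      have ht : t ≠ 0 := by rintro rfl; simp at ha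
      funext k
      simp only [Pi.smul_apply, smul_eq_mul]
      exact mul_div_mul_left _ _ ht) p

/-- The open set `{[v₀ : … : vₙ] | v_i ≠ 0}`. -/
def affineDomain (i : Fin (n + 1)) : Set (CP n) := {p | p.rep i ≠ 0}

lemma insertNth_ne_zero (i : Fin (n + 1)) (z : Fin n → ℂ) :
    (i.insertNth (1 : ℂ) z : Fin (n + 1) → ℂ) ≠ 0 := by
  intro h
  simpa using congrFun h i

/-- The inverse of the affine coordinates, putting `1` in the `i`-th place. -/
def affineParam (i : Fin (n + 1)) (z : Fin n → ℂ) : CP n :=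
  Projectivization.mk ℂ (i.insertNth (1 : ℂ) z : Fin (n + 1) → ℂ) (insertNth_ne_zero i z)

lemma mk_mem_affineDomain (i : Fin (n + 1)) (v : Fin (n + 1) → ℂ) (hv : v ≠ 0) :
    Projectivization.mk ℂ v hv ∈ affineDomain i ↔ v i ≠ 0 := by
  obtain ⟨a, ha⟩ := Projectivization.exists_smul_eq_mk_rep ℂ v hv
  simp [affineDomain, ← ha, Units.smul_def]

lemma affineCoord_mk (i : Fin (n + 1)) (v : Fin (n + 1) → ℂ) (hv : v ≠ 0) :
    affineCoord i (Projectivization.mk ℂ v hv) = fun k => v (i.succAbove k) / v i := rfl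

lemma isOpen_affineDomain (i : Fin (n + 1)) : IsOpen (affineDomain (n := n) i) := by
  rw [← isQuotientMap_mk'.isOpen_preimage]
  have : (Projectivization.mk' ℂ : { v : Fin (n + 1) → ℂ // v ≠ 0 } → CP n) ⁻¹'
      affineDomain i = {v | v.1 i ≠ 0} := by
    ext v
    simp [mk_mem_affineDomain]
  rw [this]
  exact isOpen_ne.preimage ((continuous_apply i).comp continuous_subtype_val)

lemma continuous_affineParam (i : Fin (n + 1)) : Continuous (affineParam (n := n) i) := by
  have h : Continuous fun z : Fin n → ℂ =>
      (⟨i.insertNth (1 : ℂ) z, insertNth_ne_zero i z⟩ : { v : Fin (n + 1) → ℂ // v ≠ 0 }) := by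
    refine Continuous.subtype_mk ?_ _
    refine continuous_pi fun j => ?_
    refine Fin.succAboveCases i ?_ (fun k => ?_) j
    · simpa using continuous_const
    · simpa using continuous_apply k
  exact isQuotientMap_mk'.continuous.comp h

lemma continuousOn_affineCoord (i : Fin (n + 1)) :
    ContinuousOn (affineCoord (n := n) i) (affineDomain i) := by
  rw [isQuotientMap_mk'.continuousOn_isOpen_iff (isOpen_affineDomain i)]
  refine continuousOn_pi.2 fun k => ?_
  refine ContinuousOn.div ?_ ?_ fun v hv => ?_
  · exact ((continuous_apply _).comp continuous_subtype_val).continuousOn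
  · exact ((continuous_apply _).comp continuous_subtype_val).continuousOn
  · simpa [mk_mem_affineDomain] using hv

/-- The `i`-th standard affine chart. -/
def affineChart (i : Fin (n + 1)) : OpenPartialHomeomorph (CP n) (Fin n → ℂ) where
  toFun := affineCoord i
  invFun := affineParam i
  source := affineDomain i
  target := Set.univ
  map_source' _ _ := Set.mem_univ _
  map_target' z _ := by simp [affineParam, mk_mem_affineDomain]
  left_inv' p hp := by
    induction p using Projectivization.ind with
    | h v hv =>
      rw [mk_mem_affineDomain] at hp
      rw [affineCoord_mk, affineParam, Projectivization.mk_eq_mk_iff']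
      refine ⟨(v i)⁻¹, ?_⟩
      funext j
      refine Fin.succAboveCases i ?_ (fun k => ?_) j
      · simp [hp]
      · simp [div_eq_inv_mul]
  right_inv' z _ := by
    rw [affineParam, affineCoord_mk]
    funext k
    simp
  open_source := isOpen_affineDomain i
  open_target := isOpen_univ
  continuousOn_toFun := continuousOn_affineCoord i
  continuousOn_invFun := (continuous_affineParam i).continuousOn

lemma exists_mem_affineDomain (p : CP n) : ∃ i, p ∈ affineDomain i :=
  Function.ne_iff.1 p.rep_nonzero

/-- The atlas of `CP n` consists of the `n + 1` standard affine charts. -/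
instance instChartedSpace (n : ℕ) : ChartedSpace (Fin n → ℂ) (CP n) where
  atlas := Set.range affineChart
  chartAt p := affineChart (exists_mem_affineDomain p).choose
  mem_chart_source p := (exists_mem_affineDomain p).choose_spec
  chart_mem_atlas _ := Set.mem_range_self _

instance instIsManifold (n : ℕ) : IsManifold 𝓘(ℂ, Fin n → ℂ) ω (CP n) := by
  refine isManifold_of_contDiffOn _ _ _ ?_
  rintro _ _ ⟨i, rfl⟩ ⟨j, rfl⟩
  have hins : ∀ l : Fin (n + 1),
      ContDiff ℂ ω fun z : Fin n → ℂ => (i.insertNth (1 : ℂ) z : Fin (n + 1) → ℂ) l := by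
    intro l
    refine Fin.succAboveCases i ?_ (fun k => ?_) l
    · simpa using contDiff_const
    · simpa using contDiff_apply ℂ ℂ k
  have key : ContDiffOn ℂ ω
      (fun z : Fin n → ℂ => fun k : Fin n =>
        (i.insertNth (1 : ℂ) z : Fin (n + 1) → ℂ) (j.succAbove k) /
          (i.insertNth (1 : ℂ) z : Fin (n + 1) → ℂ) j)
      {z | (i.insertNth (1 : ℂ) z : Fin (n + 1) → ℂ) j ≠ 0} :=
    contDiffOn_pi.2 fun k => (hins _).contDiffOn.div (hins _).contDiffOn fun z hz => hz
  have hsub : ((affineChart i).symm ≫ₕ affineChart j).source ⊆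
      {z | (i.insertNth (1 : ℂ) z : Fin (n + 1) → ℂ) j ≠ 0} := by
    rintro z ⟨-, hz⟩
    have hz' : affineParam i z ∈ affineDomain j := hz
    simpa [affineParam, mk_mem_affineDomain] using hz'
  refine ContDiffOn.congr (key.mono ?_) (fun z _ => rfl)
  intro z hz
  exact hsub (by simpa using hz.1)

end CP

/-! ### Holomorphic projective connections on a complex manifold -/

section ProjectiveConnections

variable (E : Type*) [NormedAddCommGroup E] [NormedSpace ℂ E]
  (M : Type*) [TopologicalSpace M] [ChartedSpace E M]

/-- A vector field on `M`. It need not have any regularity; a field that is only of interest on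
an open set has arbitrary values elsewhere. -/
abbrev VField : Type _ := Π x : M, TangentSpace 𝓘(ℂ, E) x

/-- The type of operators `∇` on vector fields; `∇ Y x (X x)` is `(∇_X Y)(x)`. -/
abbrev ConnOp : Type _ :=
  VField E M → Π x : M, TangentSpace 𝓘(ℂ, E) x →L[ℂ] TangentSpace 𝓘(ℂ, E) x

/-- A subset of `M` together with an operator on vector fields (a candidate for a local
affine connection). Only the behaviour of `cov` over `dom` matters. -/
structure LocalConn where
  /-- the domain -/
  dom : Set M
  /-- the operator -/
  cov : ConnOp E M

variable {E M} [IsManifold 𝓘(ℂ, E) ω M]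

/-- `∇` is a holomorphic connection on the holomorphic tangent bundle of the open set `U`.
Holomorphy is required over all open subsets, since `U` may carry few holomorphic vector fields. -/
structure IsHolAffineConnection (cov : ConnOp E M) (U : Set M) :
    Prop where
  isOpen : IsOpen U
  isCov : IsCovariantDerivativeOn E cov U
  holo : ∀ V : Set M, IsOpen V → V ⊆ U → ContMDiffCovariantDerivativeOn E ω cov V

/-- `∇_X Y - ∇_Y X = [X, Y]` over `U`. -/
def IsTorsionFreeOn (cov : ConnOp E M) (U : Set M) : Prop :=
  ∀ V : Set M, IsOpen V → V ⊆ U → ∀ X Y : VField E M,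
    ContMDiffOn 𝓘(ℂ, E) 𝓘(ℂ, E).tangent ω (T% X) V →
    ContMDiffOn 𝓘(ℂ, E) 𝓘(ℂ, E).tangent ω (T% Y) V →
    ∀ x ∈ V, cov Y x (X x) - cov X x (Y x) = VectorField.mlieBracket 𝓘(ℂ, E) X Y x

/-- `R(X, Y)Z = ∇_X ∇_Y Z - ∇_Y ∇_X Z - ∇_[X,Y] Z`. -/
def curvature (cov : ConnOp E M) (X Y Z : VField E M) (x : M) : TangentSpace 𝓘(ℂ, E) x :=
  cov (fun y => cov Z y (Y y)) x (X x) - cov (fun y => cov Z y (X y)) x (Y x)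
    - cov Z x (VectorField.mlieBracket 𝓘(ℂ, E) X Y x)

/-- The curvature vanishes over `U`. -/
def IsFlatOn (cov : ConnOp E M) (U : Set M) : Prop :=
  ∀ V : Set M, IsOpen V → V ⊆ U → ∀ X Y Z : VField E M,
    ContMDiffOn 𝓘(ℂ, E) 𝓘(ℂ, E).tangent ω (T% X) V →
    ContMDiffOn 𝓘(ℂ, E) 𝓘(ℂ, E).tangent ω (T% Y) V →
    ContMDiffOn 𝓘(ℂ, E) 𝓘(ℂ, E).tangent ω (T% Z) V →
    ∀ x ∈ V, curvature cov X Y Z x = 0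

/-- The velocity of a curve with complex time. -/
def velocity (γ : ℂ → M) (t : ℂ) : TangentSpace 𝓘(ℂ, E) (γ t) :=
  mfderiv 𝓘(ℂ, ℂ) 𝓘(ℂ, E) γ t (1 : ℂ)

/-- The immersed holomorphic curve `γ : D → W` is a non-parametrized geodesic of `∇`:
`∇_{γ'} γ'` is everywhere proportional to `γ'`. The derivative `∇_{γ'} γ'` at time `t` is
computed with a vector field `X`, holomorphic near `γ t`, which extends `γ'`. -/
structure IsNonparamGeodesic (cov : ConnOp E M) (W : Set M) (D : Set ℂ) (γ : ℂ → M) : Prop where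
  isOpen : IsOpen D
  mapsTo : Set.MapsTo γ D W
  holo : ContMDiffOn 𝓘(ℂ, ℂ) 𝓘(ℂ, E) ω γ D
  immersed : ∀ t ∈ D, velocity (E := E) γ t ≠ 0
  geodesic : ∀ t ∈ D, ∃ X : VField E M,
    ContMDiffAt 𝓘(ℂ, E) 𝓘(ℂ, E).tangent ω (T% X) (γ t) ∧
    (∀ᶠ s in 𝓝 t, X (γ s) = velocity γ s) ∧
    ∃ c : ℂ, cov X (γ t) (X (γ t)) = c • X (γ t)

/-- Two connections are projectively equivalent over `W` if they have there the same
non-parametrized holomorphic geodesics. -/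
def ProjEquivOn (cov cov' : ConnOp E M) (W : Set M) : Prop :=
  ∀ (D : Set ℂ) (γ : ℂ → M), IsNonparamGeodesic cov W D γ ↔ IsNonparamGeodesic cov' W D γ

/-- The affine connection on the domain of a chart `e` which corresponds under `e` to the
standard connection (the usual derivative of vector-valued functions) of the model space. -/
def chartConn (e : OpenPartialHomeomorph M E) : ConnOp E M := fun Y x =>
  (mfderiv 𝓘(ℂ, E) 𝓘(ℂ, E) e.symm (e x) : E →L[ℂ] E) ∘L
    (fderiv ℂ (fun z : E =>
      ((mfderiv 𝓘(ℂ, E) 𝓘(ℂ, E) e (e.symm z) : E →L[ℂ] E) (Y (e.symm z)) : E)) (e x)) ∘L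
    (mfderiv 𝓘(ℂ, E) 𝓘(ℂ, E) e x : E →L[ℂ] E)

/-- The collection `S` is a holomorphic projective connection on `M` (of dimension `> 1`). -/
structure IsProjConnection (S : Set (LocalConn E M)) : Prop where
  cover : ⋃ L ∈ S, L.dom = Set.univ
  connection : ∀ L ∈ S, IsHolAffineConnection L.cov L.dom
  torsionFree : ∀ L ∈ S, IsTorsionFreeOn L.cov L.dom
  compatible : ∀ L ∈ S, ∀ L' ∈ S, ProjEquivOn L.cov L'.cov (L.dom ∩ L'.dom)

/-- Two holomorphic projective connections are projectively equivalent if their union is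
a holomorphic projective connection. -/
def ProjConnectionEquiv (S T : Set (LocalConn E M)) : Prop := IsProjConnection (S ∪ T)

/-- A holomorphic projective connection is flat if it is projectively equivalent to one whose
members are flat. -/
def IsFlatProjConnection (S : Set (LocalConn E M)) : Prop :=
  ∃ T : Set (LocalConn E M), IsProjConnection T ∧ (∀ L ∈ T, IsFlatOn L.cov L.dom) ∧
    ProjConnectionEquiv S T

end ProjectiveConnections

/-- The standard flat projective connection of `CP n`: on each affine chart, the standard
connection of `ℂ^n`. -/
def CP.standardProjConnection (n : ℕ) : Set (LocalConn (Fin n → ℂ) (CP n)) :=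
  Set.range fun i : Fin (n + 1) => ⟨(affineChart i).source, chartConn (affineChart i)⟩

/-! ### Holomorphic projective structures (flat projective connections, in any dimension) -/

section ProjectiveStructures

variable {n : ℕ} {M : Type*} [TopologicalSpace M] [ChartedSpace (Fin n → ℂ) M]

/-- The collection `S` of coordinate functions, which are holomorphic embeddings of open subsets
of `M` in `CP n`, is a holomorphic projective structure on `M`: the domains cover `M`, and on
each connected component of an overlap the coordinate functions differ by a projective
transformation. -/
structure IsProjStructure (S : Set (OpenPartialHomeomorph M (CP n))) : Prop where
  cover : ⋃ φ ∈ S, φ.source = Set.univ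
  holo : ∀ φ ∈ S, ContMDiffOn 𝓘(ℂ, Fin n → ℂ) 𝓘(ℂ, Fin n → ℂ) ω φ φ.source
  holo_symm : ∀ φ ∈ S, ContMDiffOn 𝓘(ℂ, Fin n → ℂ) 𝓘(ℂ, Fin n → ℂ) ω φ.symm φ.target
  transition : ∀ φ ∈ S, ∀ ψ ∈ S, ∀ x ∈ φ.source ∩ ψ.source,
    ∃ g : PGL(Fin (n + 1), ℂ), ∀ y ∈ connectedComponentIn (φ.source ∩ ψ.source) x,
      φ y = g • ψ y

/-- Two holomorphic projective structures are equivalent if their union is one. -/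
def ProjStructureEquiv (S T : Set (OpenPartialHomeomorph M (CP n))) : Prop :=
  IsProjStructure (S ∪ T)

end ProjectiveStructures

/-- The standard projective structure of `CP n`, given by the identity map. -/
def CP.standardProjStructure (n : ℕ) : Set (OpenPartialHomeomorph (CP n) (CP n)) :=
  {OpenPartialHomeomorph.refl (CP n)}

end

/-!
Two torsion-free holomorphic connections have the same non-parametrized geodesics if and only if
`∇'_X X - ∇_X X` is everywhere proportional to `X` (Weyl). Hence the standard connections of the
affine charts are projectively equivalent, since a change of affine coordinates sends lines to
lines. Conversely, given a projective connection on `ℂP^n`, the projective acceleration of a line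
with respect to the local connections is independent of the connection, modulo the direction of the
line, and glues to a section over the whole projective line. In an affine coordinate of the line
it becomes an entire function vanishing at infinity, so it is zero by Liouville's theorem: lines are
geodesics.

In dimension one the same argument applies to the Schwarzian derivatives of the members of a
projective structure on `ℂP^1`. They agree on overlaps and so define a holomorphic quadratic
differential `q(z) dz²` on `ℂP^1`; since `q` is entire and decays like `z⁻⁴` at infinity, it
vanishes, and the members of the structure are Möbius transformations.
-/

/-! ### Holomorphic ordinary differential equations -/

section ComplexODE

open Metric Set Filter

variable {E : Type*} [NormedAddCommGroup E] [NormedSpace ℂ E] {F : E → E} {x₀ : E} {R r : ℝ}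

lemma norm_sub_le_of_hasDerivAt_ball_zero {f f' : ℂ → E} {C : ℝ}
    (hf : ∀ t ∈ ball (0 : ℂ) r, HasDerivAt f (f' t) t) (hC : ∀ t ∈ ball (0 : ℂ) r, ‖f' t‖ ≤ C)
    {t : ℂ} (ht : t ∈ ball (0 : ℂ) r) : ‖f t - f 0‖ ≤ C * r := by
  have h0 : (0 : ℂ) ∈ ball (0 : ℂ) r := mem_ball_self (pos_of_mem_ball ht)
  have hC0 : 0 ≤ C := (norm_nonneg _).trans (hC 0 h0)
  calc ‖f t - f 0‖ ≤ C * ‖t - 0‖ :=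
        (convex_ball (0 : ℂ) r).norm_image_sub_le_of_norm_hasDerivWithin_le
          (fun s hs => (hf s hs).hasDerivWithinAt) hC h0 ht
    _ ≤ C * r := by
        rw [sub_zero]
        exact mul_le_mul_of_nonneg_left (mem_ball_zero_iff.1 ht).le hC0

/-- The successive approximations of the solution of `u' = F u`, `u 0 = x₀` on the disc of radius
`r`; they stay in the closed ball of radius `R` about `x₀`. -/
structure IsPicardIteration (F : E → E) (x₀ : E) (R r : ℝ) (U : ℕ → ℂ → E) : Prop where
  apply_zero : ∀ k, U k 0 = x₀
  mapsTo : ∀ k, MapsTo (U k) (ball 0 r) (closedBall x₀ R)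
  hasDerivAt : ∀ k, ∀ t ∈ ball (0 : ℂ) r, HasDerivAt (U (k + 1)) (F (U k t)) t

lemma exists_isPicardIteration [CompleteSpace E] {C : ℝ} (hR : 0 ≤ R)
    (hF : DifferentiableOn ℂ F (closedBall x₀ R)) (hC : ∀ x ∈ closedBall x₀ R, ‖F x‖ ≤ C)
    (hr : C * r ≤ R) : ∃ U, IsPicardIteration F x₀ R r U := by
  let Admissible : (ℂ → E) → Prop := fun u =>
    u 0 = x₀ ∧ DifferentiableOn ℂ u (ball 0 r) ∧ MapsTo u (ball 0 r) (closedBall x₀ R)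
  have exists_next : ∀ u, Admissible u →
      ∃ v, Admissible v ∧ ∀ t ∈ ball (0 : ℂ) r, HasDerivAt v (F (u t)) t := by
    rintro u ⟨-, hu, hmaps⟩
    obtain ⟨v, hv0, hv⟩ := (hF.comp hu hmaps).isExactOn_ball.with_val_at 0 x₀
    refine ⟨v, ⟨hv0, fun t ht => (hv t ht).differentiableAt.differentiableWithinAt,
      fun t ht => mem_closedBall_iff_norm.2 ?_⟩, hv⟩
    rw [← hv0]
    exact (norm_sub_le_of_hasDerivAt_ball_zero hv (fun s hs => hC _ (hmaps hs)) ht).trans hr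
  choose! next hnext hderiv using exists_next
  have hU : ∀ k, Admissible (next^[k] fun _ => x₀) := by
    intro k
    induction k with
    | zero => exact ⟨rfl, differentiableOn_const _, fun t _ => mem_closedBall_self hR⟩
    | succ k ih =>
      rw [Function.iterate_succ_apply']
      exact hnext _ ih
  refine ⟨fun k => next^[k] fun _ => x₀, fun k => (hU k).1, fun k => (hU k).2.2, fun k => ?_⟩
  rw [Function.iterate_succ_apply']
  exact hderiv _ (hU k)

namespace IsPicardIteration

variable {U : ℕ → ℂ → E} {K : NNReal}

lemma dist_succ_le (hU : IsPicardIteration F x₀ R r U) (hK : LipschitzOnWith K F (closedBall x₀ R))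
    (hr : K * r ≤ 1 / 2) (k : ℕ) {t : ℂ} (ht : t ∈ ball (0 : ℂ) r) :
    dist (U k t) (U (k + 1) t) ≤ 4 * R / 2 / 2 ^ k := by
  induction k generalizing t with
  | zero =>
    linarith [dist_triangle_right (U 0 t) (U (0 + 1) t) x₀, mem_closedBall.1 (hU.mapsTo 0 ht),
      mem_closedBall.1 (hU.mapsTo (0 + 1) ht)]
  | succ k ih =>
    set δ := 4 * R / 2 / 2 ^ k
    have hδ : 0 ≤ δ := dist_nonneg.trans (ih ht)
    have hderiv : ∀ s ∈ ball (0 : ℂ) r, ‖F (U k s) - F (U (k + 1) s)‖ ≤ K * δ := fun s hs =>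
      (hK.norm_sub_le (hU.mapsTo k hs) (hU.mapsTo (k + 1) hs)).trans
        (mul_le_mul_of_nonneg_left ((dist_eq_norm _ _).symm.trans_le (ih hs)) K.2)
    have h := norm_sub_le_of_hasDerivAt_ball_zero
      (fun s hs => (hU.hasDerivAt k s hs).sub (hU.hasDerivAt (k + 1) s hs)) hderiv ht
    simp only [Pi.sub_apply, hU.apply_zero, sub_self, sub_zero] at h
    calc dist (U (k + 1) t) (U (k + 1 + 1) t) ≤ K * δ * r := (dist_eq_norm _ _).trans_le h
      _ = K * r * δ := by ring
      _ ≤ 1 / 2 * δ := by gcongr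
      _ = 4 * R / 2 / 2 ^ (k + 1) := by rw [pow_succ]; ring

lemma exists_tendstoUniformlyOn [CompleteSpace E] (hU : IsPicardIteration F x₀ R r U)
    (hK : LipschitzOnWith K F (closedBall x₀ R)) (hr : K * r ≤ 1 / 2) :
    ∃ u, TendstoUniformlyOn U u atTop (ball 0 r) := by
  have hlim : ∀ t ∈ ball (0 : ℂ) r, ∃ x, Tendsto (fun k => U k t) atTop (𝓝 x) := fun t ht =>
    cauchySeq_tendsto_of_complete
      (cauchySeq_of_le_geometric_two fun k => hU.dist_succ_le hK hr k ht)
  choose! u hu using hlim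
  have hgeom : Tendsto (fun k : ℕ => 4 * R / 2 ^ k) atTop (𝓝 0) :=
    tendsto_const_nhds.div_atTop (tendsto_pow_atTop_atTop_of_one_lt one_lt_two)
  refine ⟨u, Metric.tendstoUniformlyOn_iff.2 fun ε hε => ?_⟩
  filter_upwards [hgeom.eventually_lt_const hε] with k hk t ht
  rw [dist_comm]
  exact (dist_le_of_le_geometric_two_of_tendsto (fun k => hU.dist_succ_le hK hr k ht)
    (hu t ht) k).trans_lt hk

lemma hasDerivAt_limit (hU : IsPicardIteration F x₀ R r U)
    (hK : LipschitzOnWith K F (closedBall x₀ R)) {u : ℂ → E}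
    (hu : TendstoUniformlyOn U u atTop (ball 0 r)) {t : ℂ} (ht : t ∈ ball (0 : ℂ) r) :
    HasDerivAt u (F (u t)) t := by
  have hmaps : MapsTo u (ball 0 r) (closedBall x₀ R) := fun s hs =>
    isClosed_closedBall.mem_of_tendsto (hu.tendsto_at hs)
      (Eventually.of_forall fun k => hU.mapsTo k hs)
  have hFu : TendstoUniformlyOn (fun k s => F (U k s)) (fun s => F (u s)) atTop (ball 0 r) :=
    hK.uniformContinuousOn.comp_tendstoUniformlyOn_eventually
      (Eventually.of_forall fun k s hs => hU.mapsTo k hs) hmaps hu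
  exact hasDerivAt_of_tendstoUniformlyOn isOpen_ball hFu (Eventually.of_forall hU.hasDerivAt)
    (fun s hs => (hu.tendsto_at hs).comp (tendsto_add_atTop_nat 1)) ht

end IsPicardIteration

lemma exists_pos_mul_le_and_mul_le {C K b c : ℝ} (hb : 0 < b) (hc : 0 < c) :
    ∃ r > 0, C * r ≤ b ∧ K * r ≤ c := by
  have tendsto_mul : ∀ a : ℝ, Tendsto (a * ·) (𝓝[>] 0) (𝓝 0) := fun a =>
    ((continuous_const_mul a).tendsto' 0 0 (mul_zero a)).mono_left nhdsWithin_le_nhds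
  obtain ⟨r, hr, hCr, hKr⟩ := (eventually_mem_nhdsWithin.and
    (((tendsto_mul C).eventually_le_const hb).and ((tendsto_mul K).eventually_le_const hc))).exists
  exact ⟨r, hr, hCr, hKr⟩

theorem exists_eventually_hasDerivAt_complex [CompleteSpace E] (hF : ContDiffAt ℂ 1 F x₀) :
    ∃ u : ℂ → E, u 0 = x₀ ∧ ∀ᶠ t in 𝓝 0, HasDerivAt u (F (u t)) t := by
  obtain ⟨K, s, hs, hK⟩ := hF.exists_lipschitzOnWith
  have hdiff : ∀ᶠ x in 𝓝 x₀, DifferentiableAt ℂ F x :=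
    (hF.eventually (by decide)).mono fun x hx => hx.differentiableAt one_ne_zero
  have hbdd : ∀ᶠ x in 𝓝 x₀, ‖F x‖ < ‖F x₀‖ + 1 :=
    hF.continuousAt.norm.eventually_lt_const (lt_add_one _)
  obtain ⟨R, hR, hball⟩ := nhds_basis_closedBall.mem_iff.1 (inter_mem hs (hdiff.and hbdd))
  have hK' : LipschitzOnWith K F (closedBall x₀ R) := hK.mono fun x hx => (hball hx).1
  obtain ⟨r, hr, hrC, hrK⟩ :=
    exists_pos_mul_le_and_mul_le (C := ‖F x₀‖ + 1) (K := K) hR one_half_pos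
  obtain ⟨U, hU⟩ := exists_isPicardIteration hR.le
    (fun x hx => (hball hx).2.1.differentiableWithinAt) (fun x hx => (hball hx).2.2.le) hrC
  obtain ⟨u, hu⟩ := hU.exists_tendstoUniformlyOn hK' hrK
  refine ⟨u, ?_, ?_⟩
  · refine tendsto_nhds_unique (hu.tendsto_at (mem_ball_self hr)) ?_
    simp only [hU.apply_zero, tendsto_const_nhds_iff]
  · filter_upwards [ball_mem_nhds 0 hr] with t ht
      using hU.hasDerivAt_limit hK' hu ht

end ComplexODE

/-! ### Vector fields in a chart -/

section ChartCalculus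

open VectorField Filter

variable {E : Type*} [NormedAddCommGroup E] [NormedSpace ℂ E]
  {M : Type*} [TopologicalSpace M] [ChartedSpace E M]

/-- The derivative of a chart, with values in the model space. -/
noncomputable def dChart (e : OpenPartialHomeomorph M E) (p : M) :
    TangentSpace 𝓘(ℂ, E) p →L[ℂ] E :=
  mfderiv 𝓘(ℂ, E) 𝓘(ℂ, E) e p

/-- The derivative of the inverse of a chart, at the image of `p`. -/
noncomputable def dChartSymm (e : OpenPartialHomeomorph M E) (p : M) :
    E →L[ℂ] TangentSpace 𝓘(ℂ, E) p :=
  (mfderiv 𝓘(ℂ, E) 𝓘(ℂ, E) e.symm (e p) : E →L[ℂ] E)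

/-- The expression of a vector field in a chart, as a function on the model space. -/
noncomputable def chartRep (e : OpenPartialHomeomorph M E) (Y : VField E M) (z : E) : E :=
  dChart e (e.symm z) (Y (e.symm z))

/-- The vector field which has a given expression in a chart. -/
noncomputable def chartField (e : OpenPartialHomeomorph M E) (F : E → E) : VField E M :=
  fun p => dChartSymm e p (F (e p))

variable {e : OpenPartialHomeomorph M E}

lemma mdifferentiable_of_mem_maximalAtlas (he : e ∈ IsManifold.maximalAtlas 𝓘(ℂ, E) ω M) :
    e.MDifferentiable 𝓘(ℂ, E) 𝓘(ℂ, E) :=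
  ⟨(contMDiffOn_of_mem_maximalAtlas he).mdifferentiableOn (by simp),
    (contMDiffOn_symm_of_mem_maximalAtlas he).mdifferentiableOn (by simp)⟩

lemma dChartSymm_dChart (he : e ∈ IsManifold.maximalAtlas 𝓘(ℂ, E) ω M) {p : M}
    (hp : p ∈ e.source) (v : TangentSpace 𝓘(ℂ, E) p) : dChartSymm e p (dChart e p v) = v :=
  congrArg (fun L : E →L[ℂ] E => L v)
    ((mdifferentiable_of_mem_maximalAtlas he).symm_comp_deriv hp)

lemma dChart_dChartSymm (he : e ∈ IsManifold.maximalAtlas 𝓘(ℂ, E) ω M) {p : M}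
    (hp : p ∈ e.source) (v : E) : dChart e p (dChartSymm e p v) = v := by
  have h := congrArg (fun L : E →L[ℂ] E => L v)
    ((mdifferentiable_of_mem_maximalAtlas he).comp_symm_deriv (e.map_source hp))
  rwa [e.left_inv hp] at h

lemma dChart_injective (he : e ∈ IsManifold.maximalAtlas 𝓘(ℂ, E) ω M) {p : M}
    (hp : p ∈ e.source) : Function.Injective (dChart e p) :=
  Function.LeftInverse.injective (dChartSymm_dChart he hp)

/-- The derivative of a chart as a linear equivalence. -/
noncomputable def dChartEquiv (he : e ∈ IsManifold.maximalAtlas 𝓘(ℂ, E) ω M) {p : M}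
    (hp : p ∈ e.source) : TangentSpace 𝓘(ℂ, E) p ≃L[ℂ] E :=
  ContinuousLinearEquiv.equivOfInverse (dChart e p) (dChartSymm e p)
    (dChartSymm_dChart he hp) (dChart_dChartSymm he hp)

lemma isInvertible_mfderiv_chart (he : e ∈ IsManifold.maximalAtlas 𝓘(ℂ, E) ω M) {p : M}
    (hp : p ∈ e.source) : (mfderiv 𝓘(ℂ, E) 𝓘(ℂ, E) e p).IsInvertible :=
  ⟨dChartEquiv he hp, rfl⟩

lemma isInvertible_mfderiv_chart_symm (he : e ∈ IsManifold.maximalAtlas 𝓘(ℂ, E) ω M) {p : M}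
    (hp : p ∈ e.source) : (mfderiv 𝓘(ℂ, E) 𝓘(ℂ, E) e.symm (e p)).IsInvertible :=
  ⟨(dChartEquiv he hp).symm, rfl⟩

lemma chartRep_apply {p : M} (hp : p ∈ e.source) (Y : VField E M) :
    chartRep e Y (e p) = dChart e p (Y p) := by
  rw [chartRep, e.left_inv hp]

lemma chartField_chartRep (he : e ∈ IsManifold.maximalAtlas 𝓘(ℂ, E) ω M) {p : M}
    (hp : p ∈ e.source) (Y : VField E M) : chartField e (chartRep e Y) p = Y p := by
  rw [chartField, chartRep_apply hp, dChartSymm_dChart he hp]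

lemma chartRep_chartField (he : e ∈ IsManifold.maximalAtlas 𝓘(ℂ, E) ω M) {z : E}
    (hz : z ∈ e.target) (F : E → E) : chartRep e (chartField e F) z = F z := by
  rw [chartRep, chartField, dChart_dChartSymm he (e.map_target hz), e.right_inv hz]

lemma chartRep_chartField_eventuallyEq (he : e ∈ IsManifold.maximalAtlas 𝓘(ℂ, E) ω M) {z : E}
    (hz : z ∈ e.target) (F : E → E) : chartRep e (chartField e F) =ᶠ[𝓝 z] F := by
  filter_upwards [e.open_target.mem_nhds hz] with w hw using chartRep_chartField he hw F

lemma fderiv_chartRep_chartField_const (he : e ∈ IsManifold.maximalAtlas 𝓘(ℂ, E) ω M) {z : E}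
    (hz : z ∈ e.target) (u : E) : fderiv ℂ (chartRep e (chartField e fun _ => u)) z = 0 := by
  rw [(chartRep_chartField_eventuallyEq he hz fun _ => u).fderiv_eq, fderiv_fun_const,
    Pi.zero_apply]

lemma hasFDerivAt_comp_chart_symm (he : e ∈ IsManifold.maximalAtlas 𝓘(ℂ, E) ω M) {p : M}
    (hp : p ∈ e.source) {F : Type*} [NormedAddCommGroup F] [NormedSpace ℂ F] {g : M → F}
    (hg : MDifferentiableAt 𝓘(ℂ, E) 𝓘(ℂ, F) g p) :
    HasFDerivAt (fun z => g (e.symm z)) (mvfderiv 𝓘(ℂ, E) g p ∘L dChartSymm e p) (e p) := by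
  have hg' : HasMFDerivAt 𝓘(ℂ, E) 𝓘(ℂ, F) g (e.symm (e p))
      (mfderiv 𝓘(ℂ, E) 𝓘(ℂ, F) g p : E →L[ℂ] F) := by
    rw [e.left_inv hp]
    exact hg.hasMFDerivAt
  exact (hg'.comp (e p) ((mdifferentiable_of_mem_maximalAtlas he).mdifferentiableAt_symm
    (e.map_source hp)).hasMFDerivAt).hasFDerivAt

lemma velocity_chart_symm_comp (he : e ∈ IsManifold.maximalAtlas 𝓘(ℂ, E) ω M) {a : ℂ → E} {a' : E}
    {t : ℂ} (ht : a t ∈ e.target) (ha : HasDerivAt a a' t) :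
    velocity (E := E) (fun s => e.symm (a s)) t = dChartSymm e (e.symm (a t)) a' := by
  have hsymm := ((mdifferentiable_of_mem_maximalAtlas he).mdifferentiableAt_symm ht).hasMFDerivAt
  have hcomp := (hsymm.comp t ha.hasFDerivAt.hasMFDerivAt).mfderiv
  rw [velocity, dChartSymm, e.right_inv ht]
  exact (congrArg (fun L : ℂ →L[ℂ] E => L 1) hcomp).trans
    (congrArg (mfderiv 𝓘(ℂ, E) 𝓘(ℂ, E) e.symm (a t) : E →L[ℂ] E) (one_smul ℂ a'))

lemma fderiv_chartRep_along_curve (he : e ∈ IsManifold.maximalAtlas 𝓘(ℂ, E) ω M) {a b : ℂ → E}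
    {b' : E} {t : ℂ} (ht : a t ∈ e.target) (ha : ∀ᶠ s in 𝓝 t, HasDerivAt a (b s) s)
    (hb : HasDerivAt b b' t) {X : VField E M} (hX : DifferentiableAt ℂ (chartRep e X) (a t))
    (hXv : ∀ᶠ s in 𝓝 t, X (e.symm (a s)) = velocity (fun s => e.symm (a s)) s) :
    fderiv ℂ (chartRep e X) (a t) (b t) = b' := by
  have hat := ha.self_of_nhds
  have hXab : (fun s => chartRep e X (a s)) =ᶠ[𝓝 t] b := by
    filter_upwards [ha, hXv, hat.continuousAt.eventually (e.open_target.mem_nhds ht)]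
      with s hs hv hts
    rw [chartRep, hv, velocity_chart_symm_comp he hts hs, dChart_dChartSymm he (e.map_target hts)]
  exact (hX.hasFDerivAt.comp_hasDerivAt t hat).unique (hb.congr_of_eventuallyEq hXab)

lemma mpullback_chart (he : e ∈ IsManifold.maximalAtlas 𝓘(ℂ, E) ω M) {p : M}
    (hp : p ∈ e.source) (F : VField E E) :
    mpullback 𝓘(ℂ, E) 𝓘(ℂ, E) e F p = chartField e F p :=
  congrArg (fun L : E →L[ℂ] TangentSpace 𝓘(ℂ, E) p => L (F (e p)))
    (ContinuousLinearMap.inverse_equiv (dChartEquiv he hp))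

lemma mpullback_chart_symm (he : e ∈ IsManifold.maximalAtlas 𝓘(ℂ, E) ω M) {z : E}
    (hz : z ∈ e.target) (Y : VField E M) :
    mpullback 𝓘(ℂ, E) 𝓘(ℂ, E) e.symm Y z = chartRep e Y z := by
  have hinv : ContinuousLinearMap.inverse (dChartSymm e (e.symm z)) = dChart e (e.symm z) :=
    ContinuousLinearMap.inverse_equiv (dChartEquiv he (e.map_target hz)).symm
  rw [dChartSymm, e.right_inv hz] at hinv
  exact congrArg (fun L : TangentSpace 𝓘(ℂ, E) (e.symm z) →L[ℂ] E => L (Y (e.symm z))) hinv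

lemma mpullback_chart_symm_eventually_eq (he : e ∈ IsManifold.maximalAtlas 𝓘(ℂ, E) ω M) {z : E}
    (hz : z ∈ e.target) (Y : VField E M) :
    ∀ᶠ w in 𝓝 z, mpullback 𝓘(ℂ, E) 𝓘(ℂ, E) e.symm Y w = chartRep e Y w := by
  filter_upwards [e.open_target.mem_nhds hz] with w hw using mpullback_chart_symm he hw Y

lemma mpullback_chart_chartRep_eventually_eq (he : e ∈ IsManifold.maximalAtlas 𝓘(ℂ, E) ω M)
    {p : M} (hp : p ∈ e.source) (Y : VField E M) :
    ∀ᶠ q in 𝓝 p, mpullback 𝓘(ℂ, E) 𝓘(ℂ, E) e (chartRep e Y : VField E E) q = Y q := by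
  filter_upwards [e.open_source.mem_nhds hp] with q hq
    using (mpullback_chart he hq _).trans (chartField_chartRep he hq Y)

lemma mdifferentiableAt_vectorSpace_iff {F : VField E E} {z : E} :
    MDifferentiableAt 𝓘(ℂ, E) 𝓘(ℂ, E).tangent (T% F) z ↔ DifferentiableAt ℂ (F : E → E) z := by
  refine ⟨fun h => ?_, fun h => ?_⟩
  · exact mdifferentiableAt_iff_differentiableAt.1
      (((contMDiff_snd_tangentBundle_modelSpace E 𝓘(ℂ, E) (n := 1)).mdifferentiable
        one_ne_zero).mdifferentiableAt.comp z h)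
  · apply (mdifferentiableAt_totalSpace ..).2
    refine ⟨mdifferentiableAt_id, ?_⟩
    convert! h.mdifferentiableAt with y
    simp

lemma mlieBracket_vectorSpace (V W : VField E E) (z : E) :
    mlieBracket 𝓘(ℂ, E) V W z = fderiv ℂ (W : E → E) z (V z) - fderiv ℂ (V : E → E) z (W z) := by
  rw [← mlieBracketWithin_univ, mlieBracketWithin_eq_lieBracketWithin]
  exact congrFun (lieBracketWithin_univ (𝕜 := ℂ) (V := (V : E → E)) (W := (W : E → E))) z

variable [IsManifold 𝓘(ℂ, E) ω M] [CompleteSpace E]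

lemma contMDiffAt_iff_chartRep (he : e ∈ IsManifold.maximalAtlas 𝓘(ℂ, E) ω M) {p : M}
    (hp : p ∈ e.source) {Y : VField E M} :
    ContMDiffAt 𝓘(ℂ, E) 𝓘(ℂ, E).tangent ω (T% Y) p ↔ ContDiffAt ℂ ω (chartRep e Y) (e p) := by
  constructor
  · intro hY
    rw [← e.left_inv hp] at hY
    have hpull := hY.mpullback_vectorField_preimage
      (contMDiffAt_symm_of_mem_maximalAtlas he (e.map_source hp))
      (isInvertible_mfderiv_chart_symm he hp) (by simp)
    refine (contMDiffAt_vectorSpace_iff_contDiffAt.1 hpull).congr_of_eventuallyEq ?_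
    filter_upwards [mpullback_chart_symm_eventually_eq he (e.map_source hp) Y] with z hz
      using hz.symm
  · intro hY
    have hpull := (contMDiffAt_vectorSpace_iff_contDiffAt
      (V := (chartRep e Y : VField E E)).2 hY).mpullback_vectorField_preimage
      (contMDiffAt_of_mem_maximalAtlas he hp) (isInvertible_mfderiv_chart he hp) (by simp)
    refine hpull.congr_of_eventuallyEq ?_
    filter_upwards [mpullback_chart_chartRep_eventually_eq he hp Y] with q hq
    rw [hq]

lemma mdifferentiableAt_iff_chartRep (he : e ∈ IsManifold.maximalAtlas 𝓘(ℂ, E) ω M) {p : M}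
    (hp : p ∈ e.source) {Y : VField E M} :
    MDifferentiableAt 𝓘(ℂ, E) 𝓘(ℂ, E).tangent (T% Y) p ↔
      DifferentiableAt ℂ (chartRep e Y) (e p) := by
  constructor
  · intro hY
    rw [← e.left_inv hp] at hY
    have hpull := hY.mpullback_vectorField
      (contMDiffAt_symm_of_mem_maximalAtlas he (e.map_source hp))
      (isInvertible_mfderiv_chart_symm he hp) (by simp)
    refine (mdifferentiableAt_vectorSpace_iff.1 hpull).congr_of_eventuallyEq ?_
    filter_upwards [mpullback_chart_symm_eventually_eq he (e.map_source hp) Y] with z hz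
      using hz.symm
  · intro hY
    have hpull := (mdifferentiableAt_vectorSpace_iff
      (F := (chartRep e Y : VField E E)).2 hY).mpullback_vectorField
      (contMDiffAt_of_mem_maximalAtlas he hp) (isInvertible_mfderiv_chart he hp) (by simp)
    refine hpull.congr_of_eventuallyEq ?_
    filter_upwards [mpullback_chart_chartRep_eventually_eq he hp Y] with q hq
    rw [hq]

lemma contMDiffAt_chartField (he : e ∈ IsManifold.maximalAtlas 𝓘(ℂ, E) ω M) {p : M}
    (hp : p ∈ e.source) {F : E → E} (hF : ContDiffAt ℂ ω F (e p)) :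
    ContMDiffAt 𝓘(ℂ, E) 𝓘(ℂ, E).tangent ω (T% (chartField e F)) p :=
  (contMDiffAt_iff_chartRep he hp).2 (hF.congr_of_eventuallyEq
    (chartRep_chartField_eventuallyEq he (e.map_source hp) F))

lemma dChart_mlieBracket (he : e ∈ IsManifold.maximalAtlas 𝓘(ℂ, E) ω M) {p : M}
    (hp : p ∈ e.source) {X Y : VField E M}
    (hX : MDifferentiableAt 𝓘(ℂ, E) 𝓘(ℂ, E).tangent (T% X) p)
    (hY : MDifferentiableAt 𝓘(ℂ, E) 𝓘(ℂ, E).tangent (T% Y) p) :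
    dChart e p (mlieBracket 𝓘(ℂ, E) X Y p) =
      fderiv ℂ (chartRep e Y) (e p) (chartRep e X (e p)) -
        fderiv ℂ (chartRep e X) (e p) (chartRep e Y (e p)) := by
  rw [← e.left_inv hp] at hX hY
  have hz := e.map_source hp
  rw [← chartRep_apply hp, ← mpullback_chart_symm he hz,
    mpullback_mlieBracket hX hY (contMDiffAt_symm_of_mem_maximalAtlas he hz)
      (by simp [minSmoothness_of_isRCLikeNormedField]),
    EventuallyEq.mlieBracket_vectorField_eq
      (V := (chartRep e X : VField E E)) (W := (chartRep e Y : VField E E))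
      (mpullback_chart_symm_eventually_eq he hz X) (mpullback_chart_symm_eventually_eq he hz Y)]
  exact mlieBracket_vectorSpace _ _ _

end ChartCalculus

/-! ### The flat connection of a chart -/

section ChartConnection

open VectorField

variable {E : Type*} [NormedAddCommGroup E] [NormedSpace ℂ E]
  {M : Type*} [TopologicalSpace M] [ChartedSpace E M] {e : OpenPartialHomeomorph M E}

lemma dChart_chartConn (he : e ∈ IsManifold.maximalAtlas 𝓘(ℂ, E) ω M) {p : M}
    (hp : p ∈ e.source) (Y : VField E M) (v : TangentSpace 𝓘(ℂ, E) p) :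
    dChart e p (chartConn e Y p v) = fderiv ℂ (chartRep e Y) (e p) (dChart e p v) :=
  dChart_dChartSymm he hp _

lemma chartRep_chartConn (he : e ∈ IsManifold.maximalAtlas 𝓘(ℂ, E) ω M) {z : E}
    (hz : z ∈ e.target) (X Y : VField E M) :
    chartRep e (fun q => chartConn e Y q (X q)) z =
      fderiv ℂ (chartRep e Y) z (chartRep e X z) := by
  have h := dChart_chartConn he (e.map_target hz) Y (X (e.symm z))
  rwa [e.right_inv hz] at h

lemma chartRep_chartConn_eventuallyEq (he : e ∈ IsManifold.maximalAtlas 𝓘(ℂ, E) ω M) {z : E}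
    (hz : z ∈ e.target) (X Y : VField E M) :
    chartRep e (fun q => chartConn e Y q (X q)) =ᶠ[𝓝 z]
      fun w => fderiv ℂ (chartRep e Y) w (chartRep e X w) := by
  filter_upwards [e.open_target.mem_nhds hz] with w hw using chartRep_chartConn he hw X Y

lemma fderiv_chartRep_chartConn (he : e ∈ IsManifold.maximalAtlas 𝓘(ℂ, E) ω M) {z : E}
    (hz : z ∈ e.target) {X Y : VField E M} (hX : DifferentiableAt ℂ (chartRep e X) z)
    (hY : ContDiffAt ℂ 2 (chartRep e Y) z) (v : E) :
    fderiv ℂ (chartRep e (fun q => chartConn e Y q (X q))) z v =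
      fderiv ℂ (fderiv ℂ (chartRep e Y)) z v (chartRep e X z) +
        fderiv ℂ (chartRep e Y) z (fderiv ℂ (chartRep e X) z v) := by
  rw [(chartRep_chartConn_eventuallyEq he hz X Y).fderiv_eq, fderiv_clm_apply
    ((hY.fderiv_right (m := 1) le_rfl).differentiableAt one_ne_zero) hX]
  simp [add_comm]

lemma contMDiffAt_clm_of_apply [FiniteDimensional ℂ E] {F : Type*} [NormedAddCommGroup F]
    [NormedSpace ℂ F] {f : M → E →L[ℂ] F} {p : M}
    (h : ∀ v, ContMDiffAt 𝓘(ℂ, E) 𝓘(ℂ, F) ω (fun x => f x v) p) :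
    ContMDiffAt 𝓘(ℂ, E) 𝓘(ℂ, E →L[ℂ] F) ω f p := by
  let b := Module.finBasis ℂ E
  have hf : f = fun x => ∑ i, ContinuousLinearMap.smulRightL ℂ E F
      (LinearMap.toContinuousLinearMap (b.coord i)) (f x (b i)) := by
    ext x v
    calc f x v = f x (∑ i, b.repr v i • b i) := by rw [b.sum_repr]
      _ = ∑ i, b.repr v i • f x (b i) := by simp only [map_sum, map_smul]
      _ = _ := by simp
  rw [hf]
  exact contMDiffAt_finsetSum fun i _ =>
    (ContinuousLinearMap.contMDiff _).contMDiffAt.comp p (h (b i))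

variable [IsManifold 𝓘(ℂ, E) ω M]

lemma contMDiffAt_trivializationAt_symmL (p : M) (v : E) :
    ContMDiffAt 𝓘(ℂ, E) 𝓘(ℂ, E).tangent ω
      (T% fun q => (trivializationAt E (TangentSpace 𝓘(ℂ, E) : M → Type _) p).symmL ℂ q v) p := by
  rw [Bundle.contMDiffAt_section]
  refine (contMDiffAt_const (c := v)).congr_of_eventuallyEq ?_
  have hp := FiberBundle.mem_baseSet_trivializationAt' (F := E)
    (E := (TangentSpace 𝓘(ℂ, E) : M → Type _)) p
  filter_upwards [(Bundle.Trivialization.open_baseSet _).mem_nhds hp] with q hq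
  have h := Bundle.Trivialization.continuousLinearMapAt_symmL (R := ℂ) _ hq v
  rwa [Bundle.Trivialization.continuousLinearMapAt_apply, Bundle.Trivialization.linearMapAt_apply,
    if_pos hq] at h

lemma contMDiffAt_endomorphism_of_apply [FiniteDimensional ℂ E] {p : M}
    {A : Π x : M, TangentSpace 𝓘(ℂ, E) x →L[ℂ] TangentSpace 𝓘(ℂ, E) x}
    (h : ∀ X : VField E M, ContMDiffAt 𝓘(ℂ, E) 𝓘(ℂ, E).tangent ω (T% X) p →
      ContMDiffAt 𝓘(ℂ, E) 𝓘(ℂ, E).tangent ω (T% (fun q => A q (X q))) p) :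
    ContMDiffAt 𝓘(ℂ, E) (𝓘(ℂ, E).prod 𝓘(ℂ, E →L[ℂ] E)) ω
      (fun x => (⟨x, A x⟩ : Bundle.TotalSpace (E →L[ℂ] E)
        fun x => TangentSpace 𝓘(ℂ, E) x →L[ℂ] TangentSpace 𝓘(ℂ, E) x)) p := by
  rw [contMDiffAt_hom_bundle]
  refine ⟨contMDiffAt_id, contMDiffAt_clm_of_apply fun v => ?_⟩
  set t := trivializationAt E (TangentSpace 𝓘(ℂ, E) : M → Type _) p
  have hAv := (Bundle.contMDiffAt_section _).1 (h _ (contMDiffAt_trivializationAt_symmL p v))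
  refine hAv.congr_of_eventuallyEq ?_
  have hp : p ∈ t.baseSet := FiberBundle.mem_baseSet_trivializationAt' p
  filter_upwards [t.open_baseSet.mem_nhds hp] with q hq
  exact (t.linearMapAt_apply (R := ℂ) (A q (t.symmL ℂ q v))).trans (if_pos hq)

lemma isCovariantDerivativeOn_chartConn [CompleteSpace E]
    (he : e ∈ IsManifold.maximalAtlas 𝓘(ℂ, E) ω M) :
    IsCovariantDerivativeOn E (chartConn e) e.source where
  add {σ σ' p} hσ hσ' hp := by
    ext v
    apply dChart_injective he hp
    have hrep : chartRep e (σ + σ') = chartRep e σ + chartRep e σ' := by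
      ext z; simp [chartRep]
    rw [add_apply, map_add, dChart_chartConn he hp, dChart_chartConn he hp,
      dChart_chartConn he hp, hrep, fderiv_add ((mdifferentiableAt_iff_chartRep he hp).1 hσ)
        ((mdifferentiableAt_iff_chartRep he hp).1 hσ'), add_apply]
  leibniz {σ g p} hσ hg hp := by
    ext v
    apply dChart_injective he hp
    have hrep : chartRep e (g • σ) = (fun z => g (e.symm z)) • chartRep e σ := by
      ext z; simp [chartRep]
    rw [dChart_chartConn he hp, hrep, ((hasFDerivAt_comp_chart_symm he hp hg).smul
      ((mdifferentiableAt_iff_chartRep he hp).1 hσ).hasFDerivAt).fderiv]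
    simp only [add_apply, smul_apply, map_add, map_smul,
      dChart_chartConn he hp, ContinuousLinearMap.smulRight_apply, chartRep_apply hp,
      ContinuousLinearMap.comp_apply, dChartSymm_dChart he hp, e.left_inv hp]

lemma isTorsionFreeOn_chartConn [CompleteSpace E]
    (he : e ∈ IsManifold.maximalAtlas 𝓘(ℂ, E) ω M) :
    IsTorsionFreeOn (chartConn e) e.source := by
  intro V hV hVe X Y hX hY p hp
  have hpe := hVe hp
  apply dChart_injective he hpe
  rw [map_sub, dChart_chartConn he hpe, dChart_chartConn he hpe,
    dChart_mlieBracket he hpe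
      ((hX.contMDiffAt (hV.mem_nhds hp)).mdifferentiableAt (by simp))
      ((hY.contMDiffAt (hV.mem_nhds hp)).mdifferentiableAt (by simp)),
    chartRep_apply hpe, chartRep_apply hpe]

lemma isFlatOn_chartConn [CompleteSpace E]
    (he : e ∈ IsManifold.maximalAtlas 𝓘(ℂ, E) ω M) :
    IsFlatOn (chartConn e) e.source := by
  intro V hV hVe X Y Z hX hY hZ p hp
  have hpe := hVe hp
  have hz := e.map_source hpe
  have hX' := (hX.contMDiffAt (hV.mem_nhds hp)).mdifferentiableAt (by simp)
  have hY' := (hY.contMDiffAt (hV.mem_nhds hp)).mdifferentiableAt (by simp)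
  have hZ' := ((contMDiffAt_iff_chartRep he hpe).1
    (hZ.contMDiffAt (hV.mem_nhds hp))).of_le (m := 2) (by simp)
  have hsymm : IsSymmSndFDerivAt ℂ (chartRep e Z) (e p) := hZ'.isSymmSndFDerivAt (by simp)
  apply dChart_injective he hpe
  rw [curvature, map_sub, map_sub, dChart_chartConn he hpe, dChart_chartConn he hpe,
    dChart_chartConn he hpe, dChart_mlieBracket he hpe hX' hY',
    fderiv_chartRep_chartConn he hz ((mdifferentiableAt_iff_chartRep he hpe).1 hY') hZ',
    fderiv_chartRep_chartConn he hz ((mdifferentiableAt_iff_chartRep he hpe).1 hX') hZ',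
    chartRep_apply hpe, chartRep_apply hpe, hsymm.eq, map_sub, map_zero]
  abel

lemma contMDiffAt_chartConn_apply [CompleteSpace E]
    (he : e ∈ IsManifold.maximalAtlas 𝓘(ℂ, E) ω M) {p : M} (hp : p ∈ e.source) {X Y : VField E M}
    (hX : ContMDiffAt 𝓘(ℂ, E) 𝓘(ℂ, E).tangent ω (T% X) p)
    (hY : ContMDiffAt 𝓘(ℂ, E) 𝓘(ℂ, E).tangent ω (T% Y) p) :
    ContMDiffAt 𝓘(ℂ, E) 𝓘(ℂ, E).tangent ω (T% (fun q => chartConn e Y q (X q))) p := by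
  rw [contMDiffAt_iff_chartRep he hp] at hX hY ⊢
  exact ((hY.fderiv_right (m := ω) (by simp)).clm_apply hX).congr_of_eventuallyEq
    (chartRep_chartConn_eventuallyEq he (e.map_source hp) X Y)

lemma isHolAffineConnection_chartConn [FiniteDimensional ℂ E]
    (he : e ∈ IsManifold.maximalAtlas 𝓘(ℂ, E) ω M) :
    IsHolAffineConnection (chartConn e) e.source := by
  have := FiniteDimensional.complete ℂ E
  refine ⟨e.open_source, isCovariantDerivativeOn_chartConn he, fun V hV hVe => ⟨fun hσ p hp => ?_⟩⟩
  exact (contMDiffAt_endomorphism_of_apply fun _ hX => contMDiffAt_chartConn_apply he (hVe hp) hX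
    (hσ.contMDiffAt (hV.mem_nhds hp))).contMDiffWithinAt

end ChartConnection

/-! ### Christoffel symbols and geodesics -/

section Christoffel

open Set

variable {E : Type*} [NormedAddCommGroup E] [NormedSpace ℂ E]
  {M : Type*} [TopologicalSpace M] [ChartedSpace E M] {e : OpenPartialHomeomorph M E}
  [IsManifold 𝓘(ℂ, E) ω M] {cov : ConnOp E M} {A : E → E →L[ℂ] E →L[ℂ] E} {U : Set M}

/-- `A` is the Christoffel form over `U` of the connection `cov` in the chart `e`: in the chart,
`∇_v X = dX(v) + A(X, v)`. The field which is differentiated comes first in `A`. -/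
def IsChristoffelOn (e : OpenPartialHomeomorph M E) (cov : ConnOp E M)
    (A : E → E →L[ℂ] E →L[ℂ] E) (U : Set M) : Prop :=
  ∀ p ∈ U ∩ e.source, ∀ X : VField E M, MDifferentiableAt 𝓘(ℂ, E) 𝓘(ℂ, E).tangent (T% X) p →
    ∀ v : TangentSpace 𝓘(ℂ, E) p, dChart e p (cov X p v) =
      fderiv ℂ (chartRep e X) (e p) (dChart e p v) + A (e p) (dChart e p (X p)) (dChart e p v)

lemma IsChristoffelOn.chartRep_cov_chartField_const [CompleteSpace E]
    (he : e ∈ IsManifold.maximalAtlas 𝓘(ℂ, E) ω M) (hA : IsChristoffelOn e cov A U) {z : E}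
    (hz : z ∈ e.target ∩ e.symm ⁻¹' U) (u w : E) :
    chartRep e (fun q => cov (chartField e fun _ => u) q (chartField e (fun _ => w) q)) z =
      A z u w := by
  have hp := e.map_target hz.1
  have hu : MDifferentiableAt 𝓘(ℂ, E) 𝓘(ℂ, E).tangent (T% (chartField e fun _ => u)) (e.symm z) :=
    (contMDiffAt_chartField he hp contDiffAt_const).mdifferentiableAt (by simp)
  rw [chartRep, hA _ ⟨hz.2, hp⟩ _ hu, e.right_inv hz.1, fderiv_chartRep_chartField_const he hz.1,
    zero_apply, zero_add]
  exact congrArg₂ (fun x y => A z x y) (chartRep_chartField he hz.1 _)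
    (chartRep_chartField he hz.1 _)

variable [FiniteDimensional ℂ E]

lemma IsHolAffineConnection.exists_isChristoffelOn
    (h : IsHolAffineConnection cov U) (he : e ∈ IsManifold.maximalAtlas 𝓘(ℂ, E) ω M) :
    ∃ A, IsChristoffelOn e cov A U := by
  have := FiniteDimensional.complete ℂ E
  have hcov := h.isCov.mono (inter_subset_left (t := e.source))
  have hchart := (isCovariantDerivativeOn_chartConn he).mono (inter_subset_right (s := U))
  let D := hcov.difference hchart
  let T (z : E) : E →L[ℂ] E := dChart e (e.symm z)
  let S (z : E) : E →L[ℂ] E := dChartSymm e (e.symm z)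
  let B (z : E) : E →L[ℂ] E →L[ℂ] E := D (e.symm z)
  refine ⟨fun z => ContinuousLinearMap.compL ℂ E E E (T z) ∘L (B z).bilinearComp (S z) (S z),
    fun p hp X hX v => ?_⟩
  have hD : D p (X p) v = cov X p v - chartConn e X p v :=
    congrArg (fun L : TangentSpace 𝓘(ℂ, E) p →L[ℂ] TangentSpace 𝓘(ℂ, E) p => L v)
      (hcov.difference_apply hchart hp hX)
  calc dChart e p (cov X p v)
      = dChart e p (chartConn e X p v) + dChart e p (D p (X p) v) := by
        rw [hD, map_sub, add_sub_cancel]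
    _ = _ := by
        rw [dChart_chartConn he hp.2]
        change _ = _ + dChart e (e.symm (e p)) (D (e.symm (e p))
          (dChartSymm e (e.symm (e p)) (dChart e p (X p)))
          (dChartSymm e (e.symm (e p)) (dChart e p v)))
        rw [e.left_inv hp.2, dChartSymm_dChart he hp.2, dChartSymm_dChart he hp.2]

lemma IsChristoffelOn.contDiffOn (he : e ∈ IsManifold.maximalAtlas 𝓘(ℂ, E) ω M)
    (hA : IsChristoffelOn e cov A U) (h : IsHolAffineConnection cov U) :
    ContDiffOn ℂ ω A (e.target ∩ e.symm ⁻¹' U) := by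
  have := FiniteDimensional.complete ℂ E
  refine contDiffOn_clm_apply.2 fun u => contDiffOn_clm_apply.2 fun w z hz =>
    ContDiffAt.contDiffWithinAt ?_
  have hp := e.map_target hz.1
  have hfield (u : E) {p : M} (hp : p ∈ e.source) :
      ContMDiffAt 𝓘(ℂ, E) 𝓘(ℂ, E).tangent ω (T% (chartField e fun _ => u)) p :=
    contMDiffAt_chartField he hp contDiffAt_const
  have hV : IsOpen (U ∩ e.source) := h.isOpen.inter e.open_source
  have hcov := (((h.holo _ hV inter_subset_left).contMDiff (σ := chartField e fun _ => u)
    fun p hp => (hfield u hp.2).contMDiffWithinAt).contMDiffAt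
      (hV.mem_nhds ⟨hz.2, hp⟩)).clm_bundle_apply (hfield w hp)
  have hrep := (contMDiffAt_iff_chartRep he hp (Y := fun q =>
    cov (chartField e fun _ => u) q (chartField e (fun _ => w) q))).1 hcov
  rw [e.right_inv hz.1] at hrep
  refine hrep.congr_of_eventuallyEq ?_
  filter_upwards [(e.symm.isOpen_inter_preimage h.isOpen).mem_nhds hz] with y hy
  exact (hA.chartRep_cov_chartField_const he hy u w).symm

end Christoffel

section Geodesics

open Filter Set

lemma exists_analyticAt_comp_eventuallyEq {E F : Type*} [NormedAddCommGroup E] [NormedSpace ℂ E]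
    [NormedAddCommGroup F] [NormedSpace ℂ F] {a : ℂ → E} {b : ℂ → F} {t : ℂ}
    (ha : AnalyticAt ℂ a t) (hb : AnalyticAt ℂ b t) (ha' : deriv a t ≠ 0) :
    ∃ G : E → F, AnalyticAt ℂ G (a t) ∧ ∀ᶠ s in 𝓝 t, G (a s) = b s := by
  obtain ⟨l, hl⟩ := SeparatingDual.exists_eq_one (R := ℂ) ha'
  have hla : AnalyticAt ℂ (fun s => l (a s)) t := (l.analyticAt _).comp ha
  have hla' : deriv (fun s => l (a s)) t ≠ 0 := by
    have hd : HasDerivAt (fun s => l (a s)) (l (deriv a t)) t :=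
      l.hasFDerivAt.comp_hasDerivAt t ha.differentiableAt.hasDerivAt
    rw [hd.deriv, hl]
    exact one_ne_zero
  have hinv := hla.hasStrictDerivAt.eventually_left_inverse hla'
  refine ⟨fun x => b (hla.hasStrictDerivAt.localInverse _ _ _ hla' (l x)),
    .comp (f := fun x => hla.hasStrictDerivAt.localInverse _ _ _ hla' (l x)) ?_
      ((hla.analyticAt_localInverse hla').comp (l.analyticAt (a t))), ?_⟩
  · rwa [hinv.self_of_nhds]
  · filter_upwards [hinv] with s hs
    rw [hs]

lemma exists_geodesic_equation_solution {E : Type*} [NormedAddCommGroup E] [NormedSpace ℂ E]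
    [CompleteSpace E] {A : E → E →L[ℂ] E →L[ℂ] E} {x u : E} (hA : ContDiffAt ℂ 1 A x)
    (hu : u ≠ 0) {N : Set E} (hN : N ∈ 𝓝 x) :
    ∃ (a : ℂ → E) (D : Set ℂ), IsOpen D ∧ 0 ∈ D ∧ a 0 = x ∧ deriv a 0 = u ∧
      DifferentiableOn ℂ a D ∧ MapsTo a D N ∧ (∀ t ∈ D, deriv a t ≠ 0) ∧
      ∀ t ∈ D, deriv (deriv a) t + A (a t) (deriv a t) (deriv a t) = 0 := by
  have hF : ContDiffAt ℂ 1 (fun y : E × E => (y.2, -A y.1 y.2 y.2)) (x, u) :=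
    contDiffAt_snd.prodMk (((ContDiffAt.comp (x, u) hA contDiffAt_fst).clm_apply
      contDiffAt_snd).clm_apply contDiffAt_snd).neg
  obtain ⟨y, hy0, hy⟩ := exists_eventually_hasDerivAt_complex hF
  have hcont := hy.self_of_nhds.continuousAt
  have hyN : ∀ᶠ t in 𝓝 0, (y t).1 ∈ N :=
    (continuousAt_fst.comp hcont).eventually_mem (by simpa [hy0] using hN)
  have hyu : ∀ᶠ t in 𝓝 0, (y t).2 ≠ 0 :=
    (continuousAt_snd.comp hcont).eventually_ne (by simpa [hy0] using hu)
  obtain ⟨D, hD, hDopen, h0⟩ := eventually_nhds_iff.1 (hy.and (hyN.and hyu))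
  have ha : ∀ t ∈ D, HasDerivAt (fun s => (y s).1) (y t).2 t := fun t ht =>
    (ContinuousLinearMap.fst ℂ E E).hasFDerivAt.comp_hasDerivAt t (hD t ht).1
  have hb : ∀ t ∈ D, HasDerivAt (fun s => (y s).2) (-A (y t).1 (y t).2 (y t).2) t := fun t ht =>
    (ContinuousLinearMap.snd ℂ E E).hasFDerivAt.comp_hasDerivAt t (hD t ht).1
  have hderiv : ∀ t ∈ D, deriv (fun s => (y s).1) t = (y t).2 := fun t ht => (ha t ht).deriv
  refine ⟨fun s => (y s).1, D, hDopen, h0, congrArg Prod.fst hy0, by rw [hderiv 0 h0, hy0],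
    fun t ht => (ha t ht).differentiableAt.differentiableWithinAt, fun t ht => (hD t ht).2.1,
    fun t ht => by rw [hderiv t ht]; exact (hD t ht).2.2, fun t ht => ?_⟩
  have hderiv₂ : deriv (fun s => (y s).1) =ᶠ[𝓝 t] fun s => (y s).2 := by
    filter_upwards [hDopen.mem_nhds ht] with s hs using hderiv s hs
  rw [hderiv₂.deriv_eq, (hb t ht).deriv, hderiv t ht, neg_add_cancel]

variable {E : Type*} [NormedAddCommGroup E] [NormedSpace ℂ E]
  {M : Type*} [TopologicalSpace M] [ChartedSpace E M] {e : OpenPartialHomeomorph M E}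
  [IsManifold 𝓘(ℂ, E) ω M] {cov cov' : ConnOp E M} {A : E → E →L[ℂ] E →L[ℂ] E}
  {U U' W : Set M} {a : ℂ → E} {D : Set ℂ}

/-- `∇_X X - ∇'_X X` is proportional to `X` at each point of `W`. This is Weyl's criterion for
`∇` and `∇'` to have the same non-parametrized geodesics in `W`. -/
def HasProportionalDifferenceOn (cov cov' : ConnOp E M) (W : Set M) : Prop :=
  ∀ x ∈ W, ∀ X : VField E M, MDifferentiableAt 𝓘(ℂ, E) 𝓘(ℂ, E).tangent (T% X) x →
    ∃ c : ℂ, cov X x (X x) - cov' X x (X x) = c • X x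

lemma HasProportionalDifferenceOn.symm (h : HasProportionalDifferenceOn cov cov' W) :
    HasProportionalDifferenceOn cov' cov W := fun x hx X hX => by
  obtain ⟨c, hc⟩ := h x hx X hX
  exact ⟨-c, by rw [neg_smul, ← hc, neg_sub]⟩

lemma IsChristoffelOn.hasProportionalDifferenceOn_chartConn
    (he : e ∈ IsManifold.maximalAtlas 𝓘(ℂ, E) ω M) (hA : IsChristoffelOn e cov A U)
    (hprop : ∀ z ∈ e.target ∩ e.symm ⁻¹' U, ∀ u, ∃ c : ℂ, A z u u = c • u) :
    HasProportionalDifferenceOn cov (chartConn e) (U ∩ e.source) := fun p hp X hX => by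
  obtain ⟨c, hc⟩ := hprop (e p) ⟨e.map_source hp.2, by simpa [e.left_inv hp.2] using hp.1⟩
    (dChart e p (X p))
  refine ⟨c, dChart_injective he hp.2 ?_⟩
  rw [map_sub, hA p hp X hX, dChart_chartConn he hp.2, add_sub_cancel_left, hc, map_smul]

lemma IsNonparamGeodesic.of_hasProportionalDifferenceOn
    (h : HasProportionalDifferenceOn cov cov' W) {γ : ℂ → M}
    (hγ : IsNonparamGeodesic cov W D γ) : IsNonparamGeodesic cov' W D γ where
  isOpen := hγ.isOpen
  mapsTo := hγ.mapsTo
  holo := hγ.holo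
  immersed := hγ.immersed
  geodesic t ht := by
    obtain ⟨X, hX, hXv, c, hc⟩ := hγ.geodesic t ht
    obtain ⟨d, hd⟩ := h _ (hγ.mapsTo ht) X (hX.mdifferentiableAt (by simp))
    exact ⟨X, hX, hXv, c - d, by rw [sub_smul, ← hd, hc, sub_sub_cancel]⟩

lemma IsChristoffelOn.dChart_cov_velocity [CompleteSpace E]
    (he : e ∈ IsManifold.maximalAtlas 𝓘(ℂ, E) ω M) (hA : IsChristoffelOn e cov A U) {t : ℂ}
    (ht : a t ∈ e.target ∩ e.symm ⁻¹' U) (ha : AnalyticAt ℂ a t) {X : VField E M}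
    (hX : MDifferentiableAt 𝓘(ℂ, E) 𝓘(ℂ, E).tangent (T% X) (e.symm (a t)))
    (hXv : ∀ᶠ s in 𝓝 t, X (e.symm (a s)) = velocity (fun s => e.symm (a s)) s) :
    dChart e (e.symm (a t)) (cov X (e.symm (a t)) (X (e.symm (a t)))) =
      deriv (deriv a) t + A (a t) (deriv a t) (deriv a t) := by
  have hp := e.map_target ht.1
  have hderiv : ∀ᶠ s in 𝓝 t, HasDerivAt a (deriv a s) s :=
    ha.eventually_analyticAt.mono fun s hs => hs.differentiableAt.hasDerivAt
  have hXt : dChart e (e.symm (a t)) (X (e.symm (a t))) = deriv a t := by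
    rw [hXv.self_of_nhds, velocity_chart_symm_comp he ht.1 hderiv.self_of_nhds,
      dChart_dChartSymm he hp]
  have hrep := (mdifferentiableAt_iff_chartRep he hp).1 hX
  rw [e.right_inv ht.1] at hrep
  rw [hA _ ⟨ht.2, hp⟩ X hX, hXt, e.right_inv ht.1, fderiv_chartRep_along_curve he ht.1 hderiv
    ha.deriv.differentiableAt.hasDerivAt hrep hXv]

lemma IsChristoffelOn.isNonparamGeodesic_iff [CompleteSpace E]
    (he : e ∈ IsManifold.maximalAtlas 𝓘(ℂ, E) ω M) (hA : IsChristoffelOn e cov A U) (hWU : W ⊆ U)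
    (hD : IsOpen D) (ha : DifferentiableOn ℂ a D) (haW : MapsTo a D (e.target ∩ e.symm ⁻¹' W))
    (ha' : ∀ t ∈ D, deriv a t ≠ 0) :
    IsNonparamGeodesic cov W D (fun t => e.symm (a t)) ↔
      ∀ t ∈ D, ∃ c : ℂ, deriv (deriv a) t + A (a t) (deriv a t) (deriv a t) = c • deriv a t := by
  have hana : ∀ t ∈ D, AnalyticAt ℂ a t := fun t ht => ha.analyticAt (hD.mem_nhds ht)
  have haU : ∀ t ∈ D, a t ∈ e.target ∩ e.symm ⁻¹' U := fun t ht => ⟨(haW ht).1, hWU (haW ht).2⟩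
  have hvel : ∀ t ∈ D, velocity (E := E) (fun s => e.symm (a s)) t =
      dChartSymm e (e.symm (a t)) (deriv a t) := fun t ht =>
    velocity_chart_symm_comp he (haW ht).1 (hana t ht).differentiableAt.hasDerivAt
  have hdvel : ∀ t ∈ D, dChart e (e.symm (a t)) (velocity (fun s => e.symm (a s)) t) =
      deriv a t := fun t ht => by
    rw [hvel t ht, dChart_dChartSymm he (e.map_target (haW ht).1)]
  refine ⟨fun hγ t ht => ?_, fun hgeo => ⟨hD, fun t ht => (haW ht).2, fun t ht =>
    ((contMDiffAt_symm_of_mem_maximalAtlas he (haW ht).1).comp t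
      (hana t ht).contDiffAt.contMDiffAt).contMDiffWithinAt, fun t ht h0 => ?_, fun t ht => ?_⟩⟩
  · obtain ⟨X, hX, hXv, c, hc⟩ := hγ.geodesic t ht
    refine ⟨c, ?_⟩
    rw [← hA.dChart_cov_velocity he (haU t ht) (hana t ht) (hX.mdifferentiableAt (by simp)) hXv,
      hc, map_smul, hXv.self_of_nhds, hdvel t ht]
  · exact ha' t ht (by rw [← hdvel t ht, h0, map_zero])
  · have hp := e.map_target (haW ht).1
    obtain ⟨G, hG, hGa⟩ :=
      exists_analyticAt_comp_eventuallyEq (hana t ht) (hana t ht).deriv (ha' t ht)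
    have hX := contMDiffAt_chartField he hp (F := G)
      (by rw [e.right_inv (haW ht).1]; exact hG.contDiffAt)
    have hXv : ∀ᶠ s in 𝓝 t, chartField e G (e.symm (a s)) = velocity (fun s => e.symm (a s)) s := by
      filter_upwards [hD.mem_nhds ht, hGa] with s hs hGs
      rw [chartField, e.right_inv (haW hs).1, hGs, hvel s hs]
    obtain ⟨c, hc⟩ := hgeo t ht
    refine ⟨chartField e G, hX, hXv, c, dChart_injective he hp ?_⟩
    rw [hA.dChart_cov_velocity he (haU t ht) (hana t ht) (hX.mdifferentiableAt (by simp)) hXv,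
      hc, map_smul, hXv.self_of_nhds, hdvel t ht]

variable [FiniteDimensional ℂ E]

lemma ProjEquivOn.hasProportionalDifferenceOn (hproj : ProjEquivOn cov cov' W)
    (h : IsHolAffineConnection cov U) (h' : IsHolAffineConnection cov' U') (hW : IsOpen W)
    (hWU : W ⊆ U) (hWU' : W ⊆ U') : HasProportionalDifferenceOn cov cov' W := by
  have := FiniteDimensional.complete ℂ E
  intro x hx X hX
  rcases eq_or_ne (X x) 0 with hX0 | hX0
  · exact ⟨0, by simp [hX0]⟩
  have he : chartAt E x ∈ IsManifold.maximalAtlas 𝓘(ℂ, E) ω M := IsManifold.chart_mem_maximalAtlas x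
  have hxe := mem_chart_source E x
  set e := chartAt E x
  obtain ⟨A, hA⟩ := h.exists_isChristoffelOn he
  obtain ⟨A', hA'⟩ := h'.exists_isChristoffelOn he
  have hu : dChart e x (X x) ≠ 0 := (map_ne_zero_iff _ (dChart_injective he hxe)).2 hX0
  have hxW : e x ∈ e.target ∩ e.symm ⁻¹' W := ⟨e.map_source hxe, by simpa [e.left_inv hxe] using hx⟩
  have hWopen := e.symm.isOpen_inter_preimage hW
  have hAx : ContDiffAt ℂ 1 A (e x) := (((hA.contDiffOn he h).mono
    (inter_subset_inter_right _ (preimage_mono hWU))).contDiffAt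
      (hWopen.mem_nhds hxW)).of_le (by simp)
  obtain ⟨a, D, hD, h0, ha0, ha0', ha, haW, ha', hgeo⟩ :=
    exists_geodesic_equation_solution hAx hu (hWopen.mem_nhds hxW)
  have hγ : IsNonparamGeodesic cov W D fun t => e.symm (a t) :=
    (hA.isNonparamGeodesic_iff he hWU hD ha haW ha').2 fun t ht =>
      ⟨0, (hgeo t ht).trans (zero_smul ℂ _).symm⟩
  obtain ⟨c, hc⟩ :=
    (hA'.isNonparamGeodesic_iff he hWU' hD ha haW ha').1 ((hproj D _).1 hγ) 0 h0
  rw [eq_neg_of_add_eq_zero_left (hgeo 0 h0), ha0, ha0'] at hc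
  refine ⟨-c, dChart_injective he hxe ?_⟩
  rw [map_sub, hA x ⟨hWU hx, hxe⟩ X hX, hA' x ⟨hWU' hx, hxe⟩ X hX, map_smul, neg_smul, ← hc]
  abel

theorem projEquivOn_iff_hasProportionalDifferenceOn (h : IsHolAffineConnection cov U)
    (h' : IsHolAffineConnection cov' U') (hW : IsOpen W) (hWU : W ⊆ U) (hWU' : W ⊆ U') :
    ProjEquivOn cov cov' W ↔ HasProportionalDifferenceOn cov cov' W :=
  ⟨fun hproj => hproj.hasProportionalDifferenceOn h h' hW hWU hWU', fun hdiff _ _ =>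
    ⟨fun hγ => hγ.of_hasProportionalDifferenceOn hdiff,
      fun hγ => hγ.of_hasProportionalDifferenceOn hdiff.symm⟩⟩

end Geodesics

/-! ### Affine charts of complex projective space -/

namespace CP

open Filter Set

variable {n : ℕ}

/-- The representative with `i`-th homogeneous coordinate `1` of the point with affine
coordinates `z`. -/
noncomputable def homog (i : Fin (n + 1)) (z : Fin n → ℂ) : Fin (n + 1) → ℂ := i.insertNth 1 z

/-- The linear part of the affine map `homog i`: it puts `0` in the `i`-th place. -/
noncomputable def homogDir (i : Fin (n + 1)) (v : Fin n → ℂ) : Fin (n + 1) → ℂ := i.insertNth 0 v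

/-- The direction, in the `j`-th affine chart, of the line through `z` with direction `v` in the
`i`-th one. It is the image of `v` under the derivative of the change of coordinates at `z`, up to
the factor `(homog i z j) ^ 2`, and does not change along the line. -/
noncomputable def lineDir (i j : Fin (n + 1)) (z v : Fin n → ℂ) : Fin n → ℂ := fun k =>
  homogDir i v (j.succAbove k) * homog i z j - homog i z (j.succAbove k) * homogDir i v j

lemma homog_same (i : Fin (n + 1)) (z : Fin n → ℂ) : homog i z i = 1 :=
  Fin.insertNth_apply_same ..

lemma homog_add_smul (i : Fin (n + 1)) (z v : Fin n → ℂ) (t : ℂ) (l : Fin (n + 1)) :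
    homog i (z + t • v) l = homog i z l + t * homogDir i v l := by
  refine Fin.succAboveCases i ?_ (fun k => ?_) l <;> simp [homog, homogDir]

lemma lineDir_add_smul (i j : Fin (n + 1)) (z v : Fin n → ℂ) (t : ℂ) :
    lineDir i j (z + t • v) v = lineDir i j z v := by
  ext k
  simp only [lineDir, homog_add_smul]
  ring

lemma affineChart_mem_maximalAtlas (i : Fin (n + 1)) :
    affineChart i ∈ IsManifold.maximalAtlas 𝓘(ℂ, Fin n → ℂ) ω (CP n) :=
  IsManifold.subset_maximalAtlas (mem_range_self i)

lemma affineChart_symm_mem_source (i : Fin (n + 1)) (z : Fin n → ℂ) :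
    (affineChart i).symm z ∈ (affineChart i).source :=
  (affineChart i).map_target (mem_univ z)

lemma affineChart_symm_right_inv (i : Fin (n + 1)) (z : Fin n → ℂ) :
    affineChart i ((affineChart i).symm z) = z :=
  (affineChart i).right_inv (mem_univ z)

lemma affineChart_symm_mem_source_iff (i j : Fin (n + 1)) (z : Fin n → ℂ) :
    (affineChart i).symm z ∈ (affineChart j).source ↔ homog i z j ≠ 0 :=
  mk_mem_affineDomain j _ _

lemma affineChart_symm_apply (i j : Fin (n + 1)) (z : Fin n → ℂ) (k : Fin n) :
    affineChart j ((affineChart i).symm z) k = homog i z (j.succAbove k) / homog i z j := rfl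

lemma homog_affineChart_symm {i j : Fin (n + 1)} {z : Fin n → ℂ} (h : homog i z j ≠ 0) :
    homog j (affineChart j ((affineChart i).symm z)) i = (homog i z j)⁻¹ := by
  have hdiv (l : Fin (n + 1)) :
      homog j (affineChart j ((affineChart i).symm z)) l = homog i z l / homog i z j := by
    refine Fin.succAboveCases j ?_ (fun k => ?_) l
    · rw [homog_same, div_self h]
    · rw [← affineChart_symm_apply]
      exact Fin.insertNth_apply_succAbove (α := fun _ => ℂ) ..
  rw [hdiv, homog_same, one_div]

lemma hasDerivAt_homog_line (i j : Fin (n + 1)) (z v : Fin n → ℂ) (t : ℂ) :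
    HasDerivAt (fun s : ℂ => homog i (z + s • v) j) (homogDir i v j) t := by
  simpa [homog_add_smul] using
    ((hasDerivAt_id t).mul_const (homogDir i v j)).const_add (homog i z j)

lemma continuous_homog (i j : Fin (n + 1)) : Continuous fun z : Fin n → ℂ => homog i z j :=
  (continuous_apply j).comp (continuous_const.finInsertNth i continuous_id)

lemma continuous_lineDir (i j : Fin (n + 1)) :
    Continuous fun y : (Fin n → ℂ) × (Fin n → ℂ) => lineDir i j y.1 y.2 := by
  have hhomog (m : Fin (n + 1)) : Continuous fun y : (Fin n → ℂ) × (Fin n → ℂ) => homog i y.1 m :=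
    (continuous_homog i m).comp continuous_fst
  have hdir (m : Fin (n + 1)) :
      Continuous fun y : (Fin n → ℂ) × (Fin n → ℂ) => homogDir i y.2 m :=
    (continuous_apply m).comp (continuous_const.finInsertNth i continuous_snd)
  exact continuous_pi fun k => ((hdir _).mul (hhomog _)).sub ((hhomog _).mul (hdir _))

lemma hasLineDerivAt_affineChart {i j : Fin (n + 1)} {z : Fin n → ℂ} (h : homog i z j ≠ 0)
    (v : Fin n → ℂ) :
    HasLineDerivAt ℂ (fun y => affineChart j ((affineChart i).symm y))
      ((homog i z j ^ 2)⁻¹ • lineDir i j z v) z v := by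
  refine hasDerivAt_pi.2 fun k => ?_
  refine ((hasDerivAt_homog_line i (j.succAbove k) z v 0).div (hasDerivAt_homog_line i j z v 0)
    (by simpa using h)).congr_deriv ?_
  simp only [zero_smul, add_zero, lineDir, Pi.smul_apply, smul_eq_mul]
  rw [div_eq_inv_mul]

lemma hasFDerivAt_affineChart {i j : Fin (n + 1)} {p : CP n} (hi : p ∈ (affineChart i).source)
    (hj : p ∈ (affineChart j).source) :
    HasFDerivAt (fun y => affineChart j ((affineChart i).symm y))
      (dChart (affineChart j) p ∘L dChartSymm (affineChart i) p) (affineChart i p) :=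
  hasFDerivAt_comp_chart_symm (affineChart_mem_maximalAtlas i) hi
    ((mdifferentiable_of_mem_maximalAtlas (affineChart_mem_maximalAtlas j)).mdifferentiableAt hj)

lemma dChart_dChartSymm_affineChart {i j : Fin (n + 1)} {p : CP n}
    (hi : p ∈ (affineChart i).source) (hj : p ∈ (affineChart j).source) (v : Fin n → ℂ) :
    dChart (affineChart j) p (dChartSymm (affineChart i) p v) =
      (homog i (affineChart i p) j ^ 2)⁻¹ • lineDir i j (affineChart i p) v :=
  ((hasFDerivAt_affineChart hi hj).hasLineDerivAt v).unique (hasLineDerivAt_affineChart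
    ((affineChart_symm_mem_source_iff i j _).1 (by rwa [(affineChart i).left_inv hi])) v)

lemma chartRep_chartField_const_affineChart {i j : Fin (n + 1)} {z : Fin n → ℂ}
    (h : homog i z j ≠ 0) (u : Fin n → ℂ) :
    chartRep (affineChart j) (chartField (affineChart i) fun _ => u)
      (affineChart j ((affineChart i).symm z)) = (homog i z j ^ 2)⁻¹ • lineDir i j z u := by
  have hj := (affineChart_symm_mem_source_iff i j z).2 h
  rw [chartRep_apply hj, chartField, dChart_dChartSymm_affineChart
    (affineChart_symm_mem_source i z) hj, affineChart_symm_right_inv]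

lemma hasLineDerivAt_chartRep_chartField_const_affineChart {i j : Fin (n + 1)} {z : Fin n → ℂ}
    (h : homog i z j ≠ 0) (u : Fin n → ℂ) :
    HasLineDerivAt ℂ (fun y => chartRep (affineChart j) (chartField (affineChart i) fun _ => u)
        (affineChart j ((affineChart i).symm y)))
      ((-2 * homogDir i u j / homog i z j) • (homog i z j ^ 2)⁻¹ • lineDir i j z u) z u := by
  have hinv : HasDerivAt (fun s : ℂ => (homog i (z + s • u) j ^ 2)⁻¹)
      (-2 * homogDir i u j / homog i z j * (homog i z j ^ 2)⁻¹) 0 := by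
    refine (((hasDerivAt_homog_line i j z u 0).pow 2).inv (by simpa using h)).congr_deriv ?_
    simp only [zero_smul, add_zero, Nat.cast_ofNat, Nat.add_one_sub_one, pow_one, Pi.pow_apply]
    field_simp
  rw [smul_smul]
  refine (hinv.smul_const (lineDir i j z u)).congr_of_eventuallyEq ?_
  filter_upwards [(hasDerivAt_homog_line i j z u 0).continuousAt.eventually_ne
    (by simpa using h)] with s hs
  rw [chartRep_chartField_const_affineChart hs, lineDir_add_smul]

lemma exists_chartConn_affineChart_chartField_const_eq_smul {i j : Fin (n + 1)} {p : CP n}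
    (hi : p ∈ (affineChart i).source) (hj : p ∈ (affineChart j).source) (u : Fin n → ℂ) :
    ∃ c : ℂ, chartConn (affineChart j) (chartField (affineChart i) fun _ => u) p
        (chartField (affineChart i) (fun _ => u) p) =
      c • chartField (affineChart i) (fun _ => u) p := by
  have hei := affineChart_mem_maximalAtlas (n := n) i
  have hej := affineChart_mem_maximalAtlas (n := n) j
  have hzj : homog i (affineChart i p) j ≠ 0 :=
    (affineChart_symm_mem_source_iff i j _).1 (by rwa [(affineChart i).left_inv hi])
  have hdiff : DifferentiableAt ℂ
      (chartRep (affineChart j) (chartField (affineChart i) fun _ => u)) (affineChart j p) :=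
    (mdifferentiableAt_iff_chartRep hej hj).1
      ((contMDiffAt_chartField hei hi contDiffAt_const).mdifferentiableAt (by simp))
  have hcomp := (HasFDerivAt.comp (affineChart i p)
    (by rw [(affineChart i).left_inv hi]; exact hdiff.hasFDerivAt)
    (hasFDerivAt_affineChart hi hj)).hasLineDerivAt u
  refine ⟨-2 * homogDir i u j / homog i (affineChart i p) j, dChart_injective hej hj ?_⟩
  rw [dChart_chartConn hej hj, map_smul]
  refine (hcomp.unique
    (hasLineDerivAt_chartRep_chartField_const_affineChart hzj u)).trans ?_
  rw [← dChart_dChartSymm_affineChart hi hj, chartField]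

theorem hasProportionalDifferenceOn_chartConn_affineChart (i j : Fin (n + 1)) :
    HasProportionalDifferenceOn (chartConn (affineChart i)) (chartConn (affineChart j))
      ((affineChart i).source ∩ (affineChart j).source) := by
  have hej := affineChart_mem_maximalAtlas (n := n) j
  have hconn := isHolAffineConnection_chartConn (affineChart_mem_maximalAtlas i)
  obtain ⟨A, hA⟩ := hconn.exists_isChristoffelOn hej
  refine hA.hasProportionalDifferenceOn_chartConn hej fun z hz u => ?_
  have hp := affineChart_symm_mem_source j z
  obtain ⟨c, hc⟩ := exists_chartConn_affineChart_chartField_const_eq_smul hp hz.2 u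
  refine ⟨c, ?_⟩
  rw [← hA.chartRep_cov_chartField_const hej hz, chartRep, hc, map_smul, chartField,
    dChart_dChartSymm hej hp]

lemma isProjConnection_standard : IsProjConnection (standardProjConnection n) where
  cover := eq_univ_of_forall fun p => by
    obtain ⟨i, hi⟩ := exists_mem_affineDomain p
    exact mem_iUnion₂.2 ⟨_, mem_range_self i, hi⟩
  connection := by
    rintro _ ⟨i, rfl⟩
    exact isHolAffineConnection_chartConn (affineChart_mem_maximalAtlas i)
  torsionFree := by
    rintro _ ⟨i, rfl⟩
    exact isTorsionFreeOn_chartConn (affineChart_mem_maximalAtlas i)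
  compatible := by
    rintro _ ⟨i, rfl⟩ _ ⟨j, rfl⟩
    exact (projEquivOn_iff_hasProportionalDifferenceOn
      (isHolAffineConnection_chartConn (affineChart_mem_maximalAtlas i))
      (isHolAffineConnection_chartConn (affineChart_mem_maximalAtlas j))
      ((affineChart i).open_source.inter (affineChart j).open_source)
      inter_subset_left inter_subset_right).2
        (hasProportionalDifferenceOn_chartConn_affineChart i j)

lemma isFlatProjConnection_standard : IsFlatProjConnection (standardProjConnection n) := by
  refine ⟨_, isProjConnection_standard, ?_, ?_⟩
  · rintro _ ⟨i, rfl⟩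
    exact isFlatOn_chartConn (affineChart_mem_maximalAtlas i)
  · rw [ProjConnectionEquiv, union_self]
    exact isProjConnection_standard

end CP

/-! ### Uniqueness of the projective connection -/

section Liouville

open Filter

lemma eq_zero_of_glue_of_tendsto_cocompact {ι F : Type*} [NormedAddCommGroup F] [NormedSpace ℂ F]
    {f : ι → ℂ → F} {D : ι → Set ℂ} (hD : ∀ i, IsOpen (D i)) (hcover : ∀ t, ∃ i, t ∈ D i)
    (hf : ∀ i, DifferentiableOn ℂ (f i) (D i))
    (hagree : ∀ i j, ∀ t ∈ D i ∩ D j, f i t = f j t) {j : ι} (hj : ∀ᶠ t in cocompact ℂ, t ∈ D j)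
    (hlim : Tendsto (f j) (cocompact ℂ) (𝓝 0)) (i : ι) {t : ℂ} (ht : t ∈ D i) : f i t = 0 := by
  choose σ hσ using hcover
  have hglue (k : ι) {s : ℂ} (hs : s ∈ D k) : f (σ s) s = f k s := hagree _ _ s ⟨hσ s, hs⟩
  have hdiff : Differentiable ℂ fun s => f (σ s) s := fun s =>
    ((hf (σ s)).differentiableAt ((hD _).mem_nhds (hσ s))).congr_of_eventuallyEq (by
      filter_upwards [(hD (σ s)).mem_nhds (hσ s)] with r hr using hglue _ hr)
  rw [← hglue i ht]
  refine hdiff.apply_eq_of_tendsto_cocompact t (hlim.congr' ?_)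
  filter_upwards [hj] with s hs using (hglue j hs).symm

lemma tendsto_inv_affine_cocompact (a : ℂ) {b : ℂ} (hb : b ≠ 0) :
    Tendsto (fun t : ℂ => (a + t * b)⁻¹) (cocompact ℂ) (𝓝 0) := by
  have h : Tendsto (fun t : ℂ => a + t * b) (cocompact ℂ) (cocompact ℂ) :=
    ((Homeomorph.mulRight₀ b hb).trans (Homeomorph.addLeft a)).isClosedEmbedding.tendsto_cocompact
  rw [← Metric.cobounded_eq_cocompact] at h ⊢
  exact tendsto_inv₀_cobounded.comp h

lemma eventually_affine_ne_zero_cocompact (a : ℂ) {b : ℂ} (hb : b ≠ 0) :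
    ∀ᶠ t : ℂ in cocompact ℂ, a + t * b ≠ 0 := by
  filter_upwards [(isCompact_singleton (x := -a / b)).compl_mem_cocompact] with t ht h0
  exact ht ((eq_div_iff hb).2 (by linear_combination h0))

end Liouville

lemma exists_eq_smul_of_forall_dual {E : Type*} [NormedAddCommGroup E] [NormedSpace ℂ E]
    [FiniteDimensional ℂ E] {v w : E} (h : ∀ l : E →L[ℂ] ℂ, l v = 0 → l w = 0) :
    ∃ c : ℂ, w = c • v := by
  by_contra hc
  have hw : w ∉ Submodule.span ℂ {v} := fun hw => by
    obtain ⟨c, hc'⟩ := Submodule.mem_span_singleton.1 hw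
    exact hc ⟨c, hc'.symm⟩
  obtain ⟨l, hlw, hl⟩ := Submodule.exists_le_ker_of_notMem hw
  exact hlw (h (LinearMap.toContinuousLinearMap l)
    (hl (Submodule.mem_span_singleton_self v)))

section ProjConnection

variable {E : Type*} [NormedAddCommGroup E] [NormedSpace ℂ E]
  {M : Type*} [TopologicalSpace M] [ChartedSpace E M] [IsManifold 𝓘(ℂ, E) ω M]
  {S T : Set (LocalConn E M)} {L L' : LocalConn E M}

lemma IsProjConnection.exists_mem_dom (hS : IsProjConnection S) (p : M) : ∃ L ∈ S, p ∈ L.dom := by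
  simpa using hS.cover.ge (Set.mem_univ p)

lemma differentiableOn_comp_line {A : E → E →L[ℂ] E →L[ℂ] E} {V : Set E} (hA : ContDiffOn ℂ ω A V)
    (l : E →L[ℂ] ℂ) (z v : E) :
    DifferentiableOn ℂ (fun t : ℂ => l (A (z + t • v) v v)) {t | z + t • v ∈ V} := by
  have hline : ContDiffOn ℂ ω (fun t : ℂ => z + t • v) {t | z + t • v ∈ V} := by fun_prop
  exact l.differentiable.comp_differentiableOn ((((hA.comp hline fun _ ht => ht).clm_apply
    contDiffOn_const).clm_apply contDiffOn_const).differentiableOn (by simp))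

variable [FiniteDimensional ℂ E]

lemma IsProjConnection.hasProportionalDifferenceOn (hS : IsProjConnection S) (hL : L ∈ S)
    (hL' : L' ∈ S) : HasProportionalDifferenceOn L.cov L'.cov (L.dom ∩ L'.dom) :=
  (hS.compatible L hL L' hL').hasProportionalDifferenceOn (hS.connection L hL)
    (hS.connection L' hL') ((hS.connection L hL).isOpen.inter (hS.connection L' hL').isOpen)
    Set.inter_subset_left Set.inter_subset_right

lemma IsProjConnection.union (hS : IsProjConnection S) (hT : IsProjConnection T)
    (hST : ∀ L ∈ S, ∀ L' ∈ T, HasProportionalDifferenceOn L.cov L'.cov (L.dom ∩ L'.dom)) :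
    ProjConnectionEquiv S T := by
  have hcomp : ∀ L ∈ S, ∀ L' ∈ T, ProjEquivOn L.cov L'.cov (L.dom ∩ L'.dom) := fun L hL L' hL' =>
    (projEquivOn_iff_hasProportionalDifferenceOn (hS.connection L hL) (hT.connection L' hL')
      ((hS.connection L hL).isOpen.inter (hT.connection L' hL').isOpen)
      Set.inter_subset_left Set.inter_subset_right).2 (hST L hL L' hL')
  refine ⟨by rw [Set.biUnion_union, hS.cover, Set.univ_union], ?_, ?_, ?_⟩
  · rintro L (hL | hL)
    exacts [hS.connection L hL, hT.connection L hL]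
  · rintro L (hL | hL)
    exacts [hS.torsionFree L hL, hT.torsionFree L hL]
  · rintro L (hL | hL) L' (hL' | hL')
    · exact hS.compatible L hL L' hL'
    · exact hcomp L hL L' hL'
    · rw [Set.inter_comm]
      exact fun D γ => (hcomp L' hL' L hL D γ).symm
    · exact hT.compatible L hL L' hL'

variable {cov cov' : ConnOp E M} {A A' : E → E →L[ℂ] E →L[ℂ] E} {U U' W : Set M}
  {e : OpenPartialHomeomorph M E}

lemma HasProportionalDifferenceOn.dual_isChristoffelOn_eq
    (h : HasProportionalDifferenceOn cov cov' W)
    (he : e ∈ IsManifold.maximalAtlas 𝓘(ℂ, E) ω M) (hA : IsChristoffelOn e cov A U)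
    (hA' : IsChristoffelOn e cov' A' U') {z v : E} (hz : z ∈ e.target)
    (hzU : e.symm z ∈ U ∩ U' ∩ W) {l : E →L[ℂ] ℂ} (hl : l v = 0) :
    l (A z v v) = l (A' z v v) := by
  have := FiniteDimensional.complete ℂ E
  have hp := e.map_target hz
  obtain ⟨c, hc⟩ := h _ hzU.2 (chartField e fun _ => v)
    ((contMDiffAt_chartField he hp contDiffAt_const).mdifferentiableAt (by simp))
  have hsub : A z v v - A' z v v = c • v := by
    rw [← hA.chartRep_cov_chartField_const he ⟨hz, hzU.1.1⟩,
      ← hA'.chartRep_cov_chartField_const he ⟨hz, hzU.1.2⟩, chartRep, chartRep, ← map_sub, hc,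
      map_smul, chartField, dChart_dChartSymm he hp]
  rw [← sub_eq_zero, ← map_sub, hsub, map_smul, hl, smul_zero]

end ProjConnection

namespace CP

open Filter Set

variable {n : ℕ} {i j : Fin (n + 1)} {z v : Fin n → ℂ}

lemma exists_homogDir_ne_zero (i : Fin (n + 1)) (hv : v ≠ 0) : ∃ j, homogDir i v j ≠ 0 := by
  obtain ⟨k, hk⟩ := Function.ne_iff.1 hv
  exact ⟨i.succAbove k, by simpa [homogDir] using hk⟩

/-- The `j`-th affine coordinates of the point at infinity which the lines of direction `v` in the
`i`-th affine chart share; meaningful when `homogDir i v j ≠ 0`. -/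
noncomputable def lineInfty (i j : Fin (n + 1)) (v : Fin n → ℂ) : Fin n → ℂ :=
  fun k => homogDir i v (j.succAbove k) / homogDir i v j

lemma tendsto_affineChart_line (i : Fin (n + 1)) (z : Fin n → ℂ) (hv : homogDir i v j ≠ 0) :
    Tendsto (fun t : ℂ => affineChart j ((affineChart i).symm (z + t • v))) (cocompact ℂ)
      (𝓝 (lineInfty i j v)) := by
  refine tendsto_pi_nhds.2 fun k => ?_
  have hlim := ((tendsto_inv_affine_cocompact (homog i z j) hv).const_mul
    (homog i z (j.succAbove k) - homog i z j * homogDir i v (j.succAbove k) /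
      homogDir i v j)).const_add (homogDir i v (j.succAbove k) / homogDir i v j)
  rw [mul_zero, add_zero] at hlim
  refine hlim.congr' ?_
  filter_upwards [eventually_affine_ne_zero_cocompact (homog i z j) hv] with t ht
  rw [affineChart_symm_apply, homog_add_smul, homog_add_smul, eq_div_iff ht, add_mul,
    inv_mul_cancel_right₀ ht]
  field_simp
  ring

lemma eventually_affineChart_symm_line_mem {U : Set (CP n)} (hU : IsOpen U) (z : Fin n → ℂ)
    (hv : homogDir i v j ≠ 0) (hUv : (affineChart j).symm (lineInfty i j v) ∈ U) :
    ∀ᶠ t : ℂ in cocompact ℂ, (affineChart i).symm (z + t • v) ∈ U := by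
  have hnhds := ((affineChart j).isOpen_inter_preimage_symm hU).mem_nhds ⟨mem_univ _, hUv⟩
  filter_upwards [eventually_affine_ne_zero_cocompact (homog i z j) hv,
    (tendsto_affineChart_line i z hv).eventually hnhds] with t ht htU
  rw [← homog_add_smul] at ht
  have hmem := htU.2
  rwa [mem_preimage, (affineChart j).left_inv
    ((affineChart_symm_mem_source_iff i j _).2 ht)] at hmem

variable {cov : ConnOp (Fin n → ℂ) (CP n)} {U : Set (CP n)}
  {A A' : (Fin n → ℂ) → (Fin n → ℂ) →L[ℂ] (Fin n → ℂ) →L[ℂ] Fin n → ℂ}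

lemma exists_isChristoffelOn_affineChart_eq (hA : IsChristoffelOn (affineChart i) cov A U)
    (hA' : IsChristoffelOn (affineChart j) cov A' U) (hz : homog i z j ≠ 0)
    (hzU : (affineChart i).symm z ∈ U) (v : Fin n → ℂ) :
    ∃ c : ℂ, A z v v = c • v + (homog i z j ^ 2)⁻¹ •
      lineDir j i (affineChart j ((affineChart i).symm z))
        (A' (affineChart j ((affineChart i).symm z)) (lineDir i j z v) (lineDir i j z v)) := by
  have hei := affineChart_mem_maximalAtlas (n := n) i
  have hej := affineChart_mem_maximalAtlas (n := n) j
  have hi := affineChart_symm_mem_source i z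
  have hj := (affineChart_symm_mem_source_iff i j z).2 hz
  rw [← hA.chartRep_cov_chartField_const hei ⟨mem_univ z, hzU⟩, chartRep]
  set p := (affineChart i).symm z
  set X := chartField (affineChart i) fun _ => v with hX
  set w := affineChart j p with hw
  set B := lineDir i j z v
  have hXi : dChart (affineChart i) p (X p) = v := dChart_dChartSymm hei hi v
  have hXj : dChart (affineChart j) p (X p) = (homog i z j ^ 2)⁻¹ • B := by
    rw [hX, chartField, dChart_dChartSymm_affineChart hi hj, affineChart_symm_right_inv]
  obtain ⟨c, hc⟩ := exists_chartConn_affineChart_chartField_const_eq_smul hi hj v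
  have hcov : cov X p (X p) = c • X p +
      dChartSymm (affineChart j) p ((homog i z j ^ 2)⁻¹ • (homog i z j ^ 2)⁻¹ • A' w B B) := by
    apply dChart_injective hej hj
    rw [hA' p ⟨hzU, hj⟩ X ((contMDiffAt_chartField hei hi contDiffAt_const).mdifferentiableAt
      (by simp)), ← dChart_chartConn hej hj, hc, map_add, dChart_dChartSymm hej hj, hXj]
    simp only [map_smul, smul_apply, ← hX, hXj, ← hw]
  refine ⟨c, ?_⟩
  rw [hcov, map_add, map_smul, hXi]
  simp only [map_smul]
  rw [dChart_dChartSymm_affineChart hj hi, homog_affineChart_symm hz, inv_pow, inv_inv,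
    inv_smul_smul₀ (pow_ne_zero 2 hz)]

/-- In the `j`-th chart the velocity of the line is `(homog i (z + t • v) j ^ 2)⁻¹` times a fixed
vector, and `A` is quadratic in it: this is where the decay at infinity comes from. -/
lemma tendsto_dual_isChristoffelOn_line (hU : IsOpen U)
    (hA : IsChristoffelOn (affineChart i) cov A U) (hA' : IsChristoffelOn (affineChart j) cov A' U)
    (z : Fin n → ℂ) (hv : homogDir i v j ≠ 0)
    (hUv : (affineChart j).symm (lineInfty i j v) ∈ U) (hA'v : ContinuousAt A' (lineInfty i j v))
    {l : (Fin n → ℂ) →L[ℂ] ℂ} (hl : l v = 0) :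
    Tendsto (fun t : ℂ => l (A (z + t • v) v v)) (cocompact ℂ) (𝓝 0) := by
  set B := lineDir i j z v with hB
  have hA'B : ContinuousAt (fun w => A' w B B) (lineInfty i j v) :=
    (hA'v.clm_apply continuousAt_const).clm_apply continuousAt_const
  have hdir : ContinuousAt (fun w => lineDir j i w (A' w B B)) (lineInfty i j v) :=
    (continuous_lineDir j i).continuousAt.comp₂ continuousAt_id hA'B
  have hsq := (tendsto_inv_affine_cocompact (homog i z j) hv).pow 2
  have hlim := (l.continuous.tendsto _).comp
    (hsq.smul (hdir.tendsto.comp (tendsto_affineChart_line i z hv)))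
  rw [zero_pow two_ne_zero, zero_smul, map_zero] at hlim
  refine hlim.congr' ?_
  filter_upwards [eventually_affine_ne_zero_cocompact (homog i z j) hv,
    eventually_affineChart_symm_line_mem hU z hv hUv] with t ht htU
  rw [← homog_add_smul] at ht
  obtain ⟨c, hc⟩ := exists_isChristoffelOn_affineChart_eq hA hA' ht htU v
  rw [hc, map_add, map_smul, hl, smul_zero, zero_add, lineDir_add_smul, ← hB, homog_add_smul]
  simp only [Function.comp_apply, inv_pow]

variable {S : Set (LocalConn (Fin n → ℂ) (CP n))}

theorem exists_isChristoffelOn_affineChart_eq_smul (hS : IsProjConnection S)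
    {Γ : S → (Fin n → ℂ) → (Fin n → ℂ) →L[ℂ] (Fin n → ℂ) →L[ℂ] Fin n → ℂ}
    (hΓ : ∀ K : S, IsChristoffelOn (affineChart i) K.1.cov (Γ K) K.1.dom) (L : S)
    (hz : (affineChart i).symm z ∈ L.1.dom) (v : Fin n → ℂ) : ∃ c : ℂ, Γ L z v v = c • v := by
  rcases eq_or_ne v 0 with rfl | hv
  · exact ⟨0, by simp⟩
  refine exists_eq_smul_of_forall_dual fun l hl => ?_
  obtain ⟨j, hj⟩ := exists_homogDir_ne_zero i hv
  have hatlas := affineChart_mem_maximalAtlas (n := n)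
  have hopen (K : S) (k : Fin (n + 1)) :
      IsOpen ((affineChart k).target ∩ (affineChart k).symm ⁻¹' K.1.dom) :=
    (affineChart k).isOpen_inter_preimage_symm (hS.connection K K.2).isOpen
  obtain ⟨K, hK, hKv⟩ := hS.exists_mem_dom ((affineChart j).symm (lineInfty i j v))
  obtain ⟨A', hA'⟩ := (hS.connection K hK).exists_isChristoffelOn (hatlas j)
  have hA'cont : ContinuousAt A' (lineInfty i j v) :=
    ((hA'.contDiffOn (hatlas j) (hS.connection K hK)).contDiffAt
      ((hopen ⟨K, hK⟩ j).mem_nhds ⟨mem_univ _, hKv⟩)).continuousAt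
  have hKopen := (hS.connection K hK).isOpen
  have hzero := eq_zero_of_glue_of_tendsto_cocompact
    (D := fun K : S => {t : ℂ | z + t • v ∈ (affineChart i).target ∩
      (affineChart i).symm ⁻¹' K.1.dom})
    (f := fun K t => l (Γ K (z + t • v) v v)) (j := ⟨K, hK⟩) (t := 0)
    (fun K => (hopen K i).preimage (by fun_prop))
    (fun t => by
      obtain ⟨K, hK, h⟩ := hS.exists_mem_dom ((affineChart i).symm (z + t • v))
      exact ⟨⟨K, hK⟩, mem_univ _, h⟩)
    (fun K => differentiableOn_comp_line ((hΓ K).contDiffOn (hatlas i) (hS.connection K K.2)) l z v)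
    (fun K₁ K₂ t ht => (hS.hasProportionalDifferenceOn K₁.2 K₂.2).dual_isChristoffelOn_eq
      (hatlas i) (hΓ K₁) (hΓ K₂) (mem_univ _) ⟨⟨ht.1.2, ht.2.2⟩, ht.1.2, ht.2.2⟩ hl)
    ((eventually_affineChart_symm_line_mem hKopen z hj hKv).mono fun t ht => ⟨mem_univ _, ht⟩)
    (tendsto_dual_isChristoffelOn_line hKopen (hΓ ⟨K, hK⟩) hA' z hj hKv hA'cont hl)
    L ⟨mem_univ _, by simpa using hz⟩
  simpa using hzero

lemma projConnectionEquiv_standard (hS : IsProjConnection S) :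
    ProjConnectionEquiv S (standardProjConnection n) := by
  refine hS.union isProjConnection_standard ?_
  rintro L hL _ ⟨i, rfl⟩
  have hei := affineChart_mem_maximalAtlas (n := n) i
  choose Γ hΓ using fun K : S => (hS.connection K K.2).exists_isChristoffelOn hei
  exact (hΓ ⟨L, hL⟩).hasProportionalDifferenceOn_chartConn hei fun z hz u =>
    exists_isChristoffelOn_affineChart_eq_smul hS hΓ ⟨L, hL⟩ hz.2 u

end CP

/-! ### The Schwarzian derivative -/

section Schwarzian

open Filter

/-- The Schwarzian derivative `f''' / f' - (3 / 2) (f'' / f')²`, the obstruction to `f` being a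
Möbius transformation; meaningful where `f` is holomorphic and `f' ≠ 0`. -/
noncomputable def schwarzian (f : ℂ → ℂ) (z : ℂ) : ℂ :=
  deriv (deriv (deriv f)) z / deriv f z - 3 / 2 * (deriv (deriv f) z / deriv f z) ^ 2

lemma schwarzian_congr {f g : ℂ → ℂ} {z : ℂ} (h : f =ᶠ[𝓝 z] g) :
    schwarzian f z = schwarzian g z := by
  unfold schwarzian
  rw [h.deriv_eq, h.deriv.deriv_eq, h.deriv.deriv.deriv_eq]

lemma analyticAt_schwarzian {f : ℂ → ℂ} {z : ℂ} (hf : AnalyticAt ℂ f z) (h : deriv f z ≠ 0) :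
    AnalyticAt ℂ (schwarzian f) z := by
  have h2 : AnalyticAt ℂ (fun s => deriv (deriv f) s / deriv f s) z :=
    hf.deriv.deriv.fun_div hf.deriv h
  exact (hf.deriv.deriv.deriv.fun_div hf.deriv h).sub (analyticAt_const.mul (h2.pow 2))

lemma schwarzian_eq_of_hasDerivAt {g g₁ g₂ : ℂ → ℂ} {z g₃ : ℂ}
    (h1 : ∀ᶠ s in 𝓝 z, HasDerivAt g (g₁ s) s) (h2 : ∀ᶠ s in 𝓝 z, HasDerivAt g₁ (g₂ s) s)
    (h3 : HasDerivAt g₂ g₃ z) :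
    schwarzian g z = g₃ / g₁ z - 3 / 2 * (g₂ z / g₁ z) ^ 2 := by
  have e1 : deriv g =ᶠ[𝓝 z] g₁ := h1.mono fun s hs => hs.deriv
  have e2 : deriv (deriv g) =ᶠ[𝓝 z] g₂ := e1.deriv.trans (h2.mono fun s hs => hs.deriv)
  unfold schwarzian
  rw [e1.eq_of_nhds, e2.eq_of_nhds, e2.deriv_eq, h3.deriv]

lemma eventually_hasDerivAt_deriv {f : ℂ → ℂ} {z : ℂ} (hf : AnalyticAt ℂ f z) :
    ∀ᶠ s in 𝓝 z, HasDerivAt f (deriv f s) s :=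
  hf.eventually_analyticAt.mono fun _ hs => hs.differentiableAt.hasDerivAt

lemma schwarzian_comp {g f : ℂ → ℂ} {z : ℂ} (hg : AnalyticAt ℂ g (f z)) (hf : AnalyticAt ℂ f z)
    (hg' : deriv g (f z) ≠ 0) (hf' : deriv f z ≠ 0) :
    schwarzian (fun s => g (f s)) z = schwarzian g (f z) * deriv f z ^ 2 + schwarzian f z := by
  have hf1 := eventually_hasDerivAt_deriv hf
  have hf2 := eventually_hasDerivAt_deriv hf.deriv
  have hf3 := hf.deriv.deriv.differentiableAt.hasDerivAt
  have hg1 := hf.continuousAt.eventually (eventually_hasDerivAt_deriv hg)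
  have hg2 := hf.continuousAt.eventually (eventually_hasDerivAt_deriv hg.deriv)
  have hg3 := hg.deriv.deriv.differentiableAt.hasDerivAt
  rw [schwarzian_eq_of_hasDerivAt
    (g₁ := fun s => deriv g (f s) * deriv f s)
    (g₂ := fun s => deriv (deriv g) (f s) * deriv f s ^ 2 + deriv g (f s) * deriv (deriv f) s)
    (g₃ := deriv (deriv (deriv g)) (f z) * deriv f z ^ 3 +
      3 * deriv (deriv g) (f z) * deriv f z * deriv (deriv f) z +
      deriv g (f z) * deriv (deriv (deriv f)) z)]
  · unfold schwarzian
    field_simp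
    ring
  · filter_upwards [hf1, hg1] with s hfs hgs using hgs.comp s hfs
  · filter_upwards [hf1, hf2, hg2] with s hf1s hf2s hg2s
    refine ((hg2s.comp s hf1s).fun_mul hf2s).congr_deriv ?_
    rw [Function.comp_apply]
    ring
  · have hf1z := hf1.self_of_nhds
    have hf2z := hf2.self_of_nhds
    refine (((hg3.comp z hf1z).fun_mul (hf2z.fun_pow 2)).fun_add
      ((hg2.self_of_nhds.comp z hf1z).fun_mul hf3)).congr_deriv ?_
    simp only [Function.comp_apply, Nat.cast_ofNat, Nat.reduceSub, pow_one]
    ring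

lemma hasDerivAt_moebius {a b c d z : ℂ} (hden : c * z + d ≠ 0) :
    HasDerivAt (fun s => (a * s + b) / (c * s + d)) ((a * d - b * c) / (c * z + d) ^ 2) z := by
  refine ((((hasDerivAt_id z).const_mul a).add_const b).fun_div
    (((hasDerivAt_id z).const_mul c).add_const d) hden).congr_deriv ?_
  rw [id]
  ring

lemma schwarzian_moebius {a b c d z : ℂ} (hdet : a * d - b * c ≠ 0) (hden : c * z + d ≠ 0) :
    schwarzian (fun s => (a * s + b) / (c * s + d)) z = 0 := by
  have hden' : ∀ᶠ s in 𝓝 z, c * s + d ≠ 0 := ContinuousAt.eventually_ne (by fun_prop) hden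
  have hlin (s : ℂ) : HasDerivAt (fun s => c * s + d) c s := by
    simpa using ((hasDerivAt_id s).const_mul c).add_const d
  rw [schwarzian_eq_of_hasDerivAt (hden'.mono fun s hs => hasDerivAt_moebius hs)
    (g₂ := fun s => -(2 * c * (a * d - b * c)) / (c * s + d) ^ 3)
    (g₃ := 6 * c ^ 2 * (a * d - b * c) / (c * z + d) ^ 4)]
  · field_simp
    ring
  · filter_upwards [hden'] with s hs
    refine ((hasDerivAt_const s _).fun_div ((hlin s).fun_pow 2) (pow_ne_zero 2 hs)).congr_deriv ?_
    simp only [zero_mul, zero_sub, Nat.cast_ofNat, Nat.reduceSub, pow_one]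
    field_simp
  · refine ((hasDerivAt_const z _).fun_div ((hlin z).fun_pow 3)
      (pow_ne_zero 3 hden)).congr_deriv ?_
    simp only [zero_mul, zero_sub, Nat.cast_ofNat, Nat.reduceSub]
    field_simp
    ring

lemma schwarzian_moebius_comp {f : ℂ → ℂ} {z a b c d : ℂ} (hf : AnalyticAt ℂ f z)
    (hf' : deriv f z ≠ 0) (hdet : a * d - b * c ≠ 0) (hden : c * f z + d ≠ 0) :
    schwarzian (fun s => (a * f s + b) / (c * f s + d)) z = schwarzian f z := by
  rw [schwarzian_comp (g := fun w => (a * w + b) / (c * w + d)) (by fun_prop (disch := exact hden))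
    hf ((hasDerivAt_moebius hden).deriv ▸ div_ne_zero hdet (pow_ne_zero 2 hden)) hf',
    schwarzian_moebius hdet hden, zero_mul, zero_add]

lemma schwarzian_comp_inv {f : ℂ → ℂ} {z : ℂ} (hz : z ≠ 0) (hf : AnalyticAt ℂ f z⁻¹)
    (hf' : deriv f z⁻¹ ≠ 0) :
    schwarzian (fun s => f s⁻¹) z = schwarzian f z⁻¹ * z⁻¹ ^ 4 := by
  have hinv : schwarzian (fun s => s⁻¹) z = 0 := by
    simpa using schwarzian_moebius (a := 0) (b := 1) (c := 1) (d := 0) (z := z) (by simp)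
      (by simpa using hz)
  rw [schwarzian_comp hf (analyticAt_inv hz) hf' (by simpa using hz), hinv, deriv_inv, add_zero]
  field_simp

lemma eventuallyEq_of_hasDerivAt {f g f' : ℂ → ℂ} {z : ℂ}
    (hf : ∀ᶠ s in 𝓝 z, HasDerivAt f (f' s) s) (hg : ∀ᶠ s in 𝓝 z, HasDerivAt g (f' s) s)
    (hz : f z = g z) : f =ᶠ[𝓝 z] g := by
  obtain ⟨r, hr, hball⟩ := Metric.eventually_nhds_iff_ball.1 (hf.and hg)
  filter_upwards [Metric.ball_mem_nhds z hr] with s hs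
  exact Metric.isOpen_ball.eqOn_of_deriv_eq (convex_ball z r).isPreconnected
    (fun t ht => (hball t ht).1.differentiableAt.differentiableWithinAt)
    (fun t ht => (hball t ht).2.differentiableAt.differentiableWithinAt)
    (fun t ht => (hball t ht).1.deriv.trans (hball t ht).2.deriv.symm)
    (Metric.mem_ball_self hr) hz hs

lemma eventually_ode_of_schwarzian_eq_zero {f : ℂ → ℂ} {z : ℂ} (hf : AnalyticAt ℂ f z)
    (hf' : deriv f z ≠ 0) (hS : ∀ᶠ s in 𝓝 z, schwarzian f s = 0) :
    ∀ᶠ s in 𝓝 z, 2 * deriv (deriv (deriv f)) s * deriv f s = 3 * deriv (deriv f) s ^ 2 := by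
  filter_upwards [hS, hf.deriv.continuousAt.eventually_ne hf'] with s hs hs'
  unfold schwarzian at hs
  field_simp at hs
  linear_combination hs

lemma deriv_sq_div_eventuallyEq_of_schwarzian_eq_zero {f : ℂ → ℂ} {z : ℂ} (hf : AnalyticAt ℂ f z)
    (hf' : deriv f z ≠ 0) (hS : ∀ᶠ s in 𝓝 z, schwarzian f s = 0) :
    (fun s => deriv (deriv f) s ^ 2 / (2 * deriv f s ^ 3)) =ᶠ[𝓝 z]
      fun _ => deriv (deriv f) z ^ 2 / (2 * deriv f z ^ 3) := by
  refine eventuallyEq_of_hasDerivAt (f' := 0) ?_ (.of_forall fun s => hasDerivAt_const s _) rfl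
  filter_upwards [hf.deriv.continuousAt.eventually_ne hf',
    eventually_ode_of_schwarzian_eq_zero hf hf' hS, eventually_hasDerivAt_deriv hf.deriv,
    eventually_hasDerivAt_deriv hf.deriv.deriv] with s hs hs0 hd2 hd3
  refine ((hd3.fun_pow 2).fun_div ((hd2.fun_pow 3).const_mul 2)
    (by simpa using hs)).congr_deriv ?_
  simp only [Pi.zero_apply]
  field_simp
  linear_combination deriv (deriv f) s * deriv f s ^ 2 * hs0

/-- If `S(f) = 0` then `(1 / f')''' = 0`, and the discriminant of the quadratic polynomial `1 / f'`
vanishes. -/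
lemma inv_deriv_eventuallyEq_of_schwarzian_eq_zero {f : ℂ → ℂ} {z : ℂ} (hf : AnalyticAt ℂ f z)
    (hf' : deriv f z ≠ 0) (hS : ∀ᶠ s in 𝓝 z, schwarzian f s = 0) :
    (fun s => (deriv f s)⁻¹) =ᶠ[𝓝 z] fun s =>
      (deriv f z)⁻¹ * (1 - deriv (deriv f) z / (2 * deriv f z) * (s - z)) ^ 2 := by
  have hne : ∀ᶠ s in 𝓝 z, deriv f s ≠ 0 := hf.deriv.continuousAt.eventually_ne hf'
  have h2 := eventually_hasDerivAt_deriv hf.deriv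
  have h3 := eventually_hasDerivAt_deriv hf.deriv.deriv
  have hode := eventually_ode_of_schwarzian_eq_zero hf hf' hS
  have hp'' := deriv_sq_div_eventuallyEq_of_schwarzian_eq_zero hf hf' hS
  have hp' : (fun s => -(deriv (deriv f) s / deriv f s ^ 2)) =ᶠ[𝓝 z] fun s =>
      deriv (deriv f) z ^ 2 / (2 * deriv f z ^ 3) * (s - z) -
        deriv (deriv f) z / deriv f z ^ 2 := by
    refine eventuallyEq_of_hasDerivAt
      (f' := fun s => deriv (deriv f) s ^ 2 / (2 * deriv f s ^ 3)) ?_ ?_ (by ring)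
    · filter_upwards [hne, hode, h2, h3] with s hs hs0 hd2 hd3
      refine (hd3.fun_div (hd2.fun_pow 2) (pow_ne_zero 2 hs)).fun_neg.congr_deriv ?_
      field_simp
      linear_combination -deriv f s * hs0
    · filter_upwards [hp''] with s hs
      refine ((((hasDerivAt_id s).sub_const z).const_mul _).sub_const _).congr_deriv ?_
      rw [hs, mul_one]
  refine eventuallyEq_of_hasDerivAt (f' := fun s => -(deriv (deriv f) s / deriv f s ^ 2)) ?_ ?_
    (by simp)
  · filter_upwards [hne, h2] with s hs hd2
    exact (hd2.fun_inv hs).congr_deriv (neg_div _ _)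
  · filter_upwards [hp'] with s hs
    refine ((((((hasDerivAt_id s).sub_const z).const_mul _).const_sub 1).fun_pow 2).const_mul
      _).congr_deriv ?_
    simp only [hs, id, Nat.cast_ofNat, Nat.reduceSub, pow_one]
    field_simp
    ring

lemma exists_moebius_of_schwarzian_eq_zero {f : ℂ → ℂ} {z : ℂ} (hf : AnalyticAt ℂ f z)
    (hf' : deriv f z ≠ 0) (hS : ∀ᶠ s in 𝓝 z, schwarzian f s = 0) :
    ∃ a b c d : ℂ, a * d - b * c ≠ 0 ∧ c * z + d ≠ 0 ∧
      ∀ᶠ s in 𝓝 z, f s = (a * s + b) / (c * s + d) := by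
  set k := deriv (deriv f) z / (2 * deriv f z) with hk
  have hdet : (deriv f z - f z * k) * (1 + k * z) -
      (f z * (1 + k * z) - deriv f z * z) * -k = deriv f z := by ring
  have hden : -k * z + (1 + k * z) ≠ 0 := by
    rw [show -k * z + (1 + k * z) = 1 by ring]
    exact one_ne_zero
  refine ⟨deriv f z - f z * k, f z * (1 + k * z) - deriv f z * z, -k, 1 + k * z, by rwa [hdet],
    hden, eventuallyEq_of_hasDerivAt (eventually_hasDerivAt_deriv hf) ?_ ?_⟩
  · have hne : ∀ᶠ s in 𝓝 z, -k * s + (1 + k * z) ≠ 0 :=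
      ContinuousAt.eventually_ne (by fun_prop) hden
    filter_upwards [hne, inv_deriv_eventuallyEq_of_schwarzian_eq_zero hf hf' hS] with s hs hinv
    refine (hasDerivAt_moebius hs).congr_deriv ?_
    rw [hdet, ← inv_inv (deriv f s), hinv, mul_inv, inv_inv, div_eq_mul_inv, ← hk,
      show 1 - k * (s - z) = -k * s + (1 + k * z) by ring]
  · rw [eq_div_iff hden]
    ring

end Schwarzian

/-! ### Projective transformations -/

section Eigenvectors

open Filter

variable {𝕜 E : Type*} [NontriviallyNormedField 𝕜] [AddCommGroup E] [TopologicalSpace E]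
  [IsTopologicalAddGroup E] [Module 𝕜 E] [ContinuousSMul 𝕜 E]

lemma exists_ne_of_eventually_nhds_line {p : E → Prop} {v₀ : E} (h : ∀ᶠ v in 𝓝 v₀, p v) (w : E) :
    ∃ s t : 𝕜, s ≠ 0 ∧ t ≠ 0 ∧ s ≠ t ∧ p (v₀ + s • w) ∧ p (v₀ + t • w) := by
  have hline : Tendsto (fun s : 𝕜 => v₀ + s • w) (𝓝[≠] 0) (𝓝 v₀) := by
    refine Tendsto.mono_left ?_ nhdsWithin_le_nhds
    exact (by fun_prop : Continuous fun s : 𝕜 => v₀ + s • w).tendsto' 0 v₀ (by simp)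
  obtain ⟨t, ht, ht0⟩ := ((hline.eventually h).and eventually_mem_nhdsWithin).exists
  obtain ⟨s, hs, hs0, hst⟩ := ((hline.eventually h).and (eventually_mem_nhdsWithin.and
    (nhdsWithin_le_nhds (isOpen_ne.mem_nhds (Ne.symm ht0))))).exists
  exact ⟨s, t, hs0, ht0, hst, hs, ht⟩

lemma exists_forall_map_eq_smul_of_eventually (f : E →ₗ[𝕜] E) {v₀ : E} (hv₀ : v₀ ≠ 0)
    (h : ∀ᶠ v in 𝓝 v₀, ∃ c : 𝕜, f v = c • v) : ∃ c : 𝕜, ∀ w, f w = c • w := by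
  obtain ⟨c₀, hc₀⟩ := h.self_of_nhds
  refine ⟨c₀, fun w => ?_⟩
  by_cases hind : LinearIndependent 𝕜 ![v₀, w]
  · obtain ⟨s, t, hs0, ht0, hst, ⟨a, ha⟩, ⟨b, hb⟩⟩ := exists_ne_of_eventually_nhds_line (𝕜 := 𝕜) h w
    have hsolve {s a : 𝕜} (hs : s ≠ 0) (ha : f (v₀ + s • w) = a • (v₀ + s • w)) :
        f w = (s⁻¹ * (a - c₀)) • v₀ + a • w := by
      rw [map_add, map_smul, hc₀] at ha
      rw [← inv_smul_smul₀ hs (f w), eq_sub_of_add_eq' ha]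
      match_scalars <;> field_simp
    have hcoeff := hind.eq_of_pair ((hsolve hs0 ha).symm.trans (hsolve ht0 hb))
    obtain rfl : a = b := hcoeff.2
    have hzero : a - c₀ = 0 := by
      by_contra hne
      exact hst (inv_injective (mul_right_cancel₀ hne hcoeff.1))
    rw [hsolve hs0 ha, hzero, mul_zero, zero_smul, zero_add, sub_eq_zero.1 hzero]
  · obtain ⟨k, rfl⟩ : ∃ k : 𝕜, k • v₀ = w := by
      simpa only [LinearIndependent.pair_iff' hv₀, not_forall, not_not] using hind
    rw [map_smul, hc₀, smul_comm]

end Eigenvectors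

namespace CP

open Filter Set

variable {n : ℕ}

lemma eq_one_of_eventually_smul_eq {g : PGL(Fin (n + 1), ℂ)} {x : CP n}
    (h : ∀ᶠ y in 𝓝 x, g • y = y) : g = 1 := by
  obtain ⟨m, rfl⟩ := Matrix.ProjGenLinGroup.mk_surjective g
  obtain ⟨⟨v₀, hv₀⟩, rfl⟩ := isQuotientMap_mk'.surjective x
  have heigen : ∀ᶠ v in 𝓝 v₀, ∃ c : ℂ, m.1.mulVecLin v = c • v := by
    rw [← map_nhds_subtype_coe_eq_nhds (p := fun v => v ≠ 0) hv₀
      (isOpen_ne.mem_nhds hv₀), eventually_map]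
    filter_upwards [isQuotientMap_mk'.continuous.continuousAt.eventually h] with v hv
    obtain ⟨c, hc⟩ := (Projectivization.mk_eq_mk_iff' ℂ _ _ _ _).1 hv
    exact ⟨c, hc.symm⟩
  obtain ⟨c, hc⟩ := exists_forall_map_eq_smul_of_eventually m.1.mulVecLin hv₀ heigen
  have hm : m.1 = Matrix.scalar (Fin (n + 1)) c := by
    refine Matrix.ext_of_mulVec_single fun k => ?_
    rw [Matrix.scalar_apply, ← Matrix.smul_one_eq_diagonal, Matrix.smul_mulVec, Matrix.one_mulVec]
    exact hc (Pi.single k 1)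
  rw [Matrix.ProjGenLinGroup.mk_eq_one,
    Matrix.GeneralLinearGroup.mem_center_iff_val_mem_range_scalar]
  exact ⟨c, hm.symm⟩

lemma eq_of_eventually_smul_eq_smul {g g' : PGL(Fin (n + 1), ℂ)} {x : CP n}
    (h : ∀ᶠ y in 𝓝 x, g • y = g' • y) : g = g' :=
  (inv_mul_eq_one.1 (eq_one_of_eventually_smul_eq (x := x) (h.mono fun y hy => by
    rw [mul_smul, hy, inv_smul_smul]))).symm

lemma exists_eq_smul_on_connectedComponentIn {φ : CP n → CP n} {U : Set (CP n)} (hU : IsOpen U)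
    (hφ : ∀ y ∈ U, ∃ g : PGL(Fin (n + 1), ℂ), ∀ᶠ w in 𝓝 y, φ w = g • w) {x : CP n} (hx : x ∈ U) :
    ∃ g : PGL(Fin (n + 1), ℂ), ∀ y ∈ connectedComponentIn U x, φ y = g • y := by
  choose! G hG using hφ
  have hsub := connectedComponentIn_subset U x
  refine ⟨G x, fun y hy => ?_⟩
  have hconst : G x = G y := by
    refine isPreconnected_connectedComponentIn.induction₂ (fun y y' => G y = G y')
      (fun y hy => ?_) (fun _ _ _ _ _ _ h h' => h.trans h') (fun _ _ _ _ h => h.symm)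
      (mem_connectedComponentIn hx) hy
    refine eventually_nhdsWithin_of_eventually_nhds ?_
    filter_upwards [(hG y (hsub hy)).eventually_nhds, hU.mem_nhds (hsub hy)] with y' hy' hyU
    refine eq_of_eventually_smul_eq_smul (x := y') ?_
    filter_upwards [hy', hG y' hyU] with w hw hw'
    rw [← hw, hw']
  rw [hconst]
  exact (hG y (hsub hy)).self_of_nhds

end CP

/-! ### Projective structures on the projective line -/

lemma det_fin_two_succAbove {R : Type*} [CommRing R] (A : Matrix (Fin 2) (Fin 2) R) (i j : Fin 2) :
    A (j.succAbove 0) (i.succAbove 0) * A j i - A (j.succAbove 0) i * A j (i.succAbove 0) =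
      (-1) ^ (i + j : ℕ) * A.det := by
  rw [Matrix.det_fin_two]
  fin_cases i <;> fin_cases j <;> simp <;> ring

namespace CP

open Filter Set

/-- The affine coordinate on the projective line with pole at the zero of the `i`-th homogeneous
coordinate. -/
noncomputable def coord (i : Fin 2) (p : CP 1) : ℂ := affineChart i p 0

/-- The point of the projective line with given affine coordinate, inverse to `coord i`. -/
noncomputable def param (i : Fin 2) (z : ℂ) : CP 1 := (affineChart i).symm fun _ => z

/-- The expression of a self-map of the projective line in the affine coordinates `coord i` on the
source and `coord j` on the target; meaningful on `coordDomain i j φ`. -/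
noncomputable def coordRep (i j : Fin 2) (φ : CP 1 → CP 1) (z : ℂ) : ℂ := coord j (φ (param i z))

/-- The domain on which the partially defined self-map `φ` of the projective line is expressed by
`coordRep i j φ`. -/
def coordDomain (i j : Fin 2) (φ : OpenPartialHomeomorph (CP 1) (CP 1)) : Set ℂ :=
  {z | param i z ∈ φ.source ∧ φ (param i z) ∈ (affineChart j).source}

section Coordinates

variable {i j : Fin 2} {p : CP 1} {z : ℂ} {φ : OpenPartialHomeomorph (CP 1) (CP 1)}

lemma mem_coordDomain : z ∈ coordDomain i j φ ↔
    param i z ∈ φ.source ∧ φ (param i z) ∈ (affineChart j).source := Iff.rfl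

lemma param_mem_source (i : Fin 2) (z : ℂ) : param i z ∈ (affineChart i).source :=
  affineChart_symm_mem_source i _

lemma coord_param (i : Fin 2) (z : ℂ) : coord i (param i z) = z :=
  congrFun (affineChart_symm_right_inv i _) 0

lemma param_coord (hp : p ∈ (affineChart i).source) : param i (coord i p) = p := by
  have hconst : (fun _ : Fin 1 => coord i p) = affineChart i p :=
    funext fun k => congrArg (affineChart i p) (Subsingleton.elim 0 k)
  rw [param, hconst, (affineChart i).left_inv hp]

lemma param_eq_param_inv (i : Fin 2) (hz : z ≠ 0) : param i z = param (i.succAbove 0) z⁻¹ := by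
  refine (Projectivization.mk_eq_mk_iff' ℂ _ _ _ _).2 ⟨z, ?_⟩
  ext l
  fin_cases i <;> fin_cases l <;> simp [hz, Fin.insertNth, Fin.succAboveCases]

lemma contMDiff_param (i : Fin 2) : ContMDiff 𝓘(ℂ, ℂ) 𝓘(ℂ, Fin 1 → ℂ) ω (param i) := fun z =>
  (contMDiffAt_symm_of_mem_maximalAtlas (affineChart_mem_maximalAtlas i) (mem_univ _)).comp z
    (contDiff_pi.2 fun _ => contDiff_id).contMDiff.contMDiffAt

lemma contMDiffAt_coord (hp : p ∈ (affineChart i).source) :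
    ContMDiffAt 𝓘(ℂ, Fin 1 → ℂ) 𝓘(ℂ, ℂ) ω (coord i) p :=
  (contDiff_apply ℂ ℂ (0 : Fin 1)).contMDiff.contMDiffAt.comp p
    (contMDiffAt_of_mem_maximalAtlas (affineChart_mem_maximalAtlas i) hp)

lemma isOpen_coordDomain (i j : Fin 2) (φ : OpenPartialHomeomorph (CP 1) (CP 1)) :
    IsOpen (coordDomain i j φ) :=
  (φ.isOpen_inter_preimage (affineChart j).open_source).preimage (contMDiff_param i).continuous

lemma mem_coordDomain_iff_inv_mem (hz : z ≠ 0) :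
    z ∈ coordDomain i j φ ↔ z⁻¹ ∈ coordDomain (i.succAbove 0) j φ := by
  rw [mem_coordDomain, mem_coordDomain, param_eq_param_inv i hz]

lemma coordRep_mem_coordDomain_symm (hz : z ∈ coordDomain i j φ) :
    coordRep i j φ z ∈ coordDomain j i φ.symm := by
  rw [mem_coordDomain, coordRep, param_coord hz.2, φ.left_inv hz.1]
  exact ⟨φ.map_source hz.1, param_mem_source i z⟩

lemma coordRep_symm_coordRep (hz : z ∈ coordDomain i j φ) :
    coordRep j i φ.symm (coordRep i j φ z) = z := by
  rw [coordRep, coordRep, param_coord hz.2, φ.left_inv hz.1, coord_param]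

lemma analyticAt_coordRep
    (hφ : ContMDiffOn 𝓘(ℂ, Fin 1 → ℂ) 𝓘(ℂ, Fin 1 → ℂ) ω φ φ.source)
    (hz : z ∈ coordDomain i j φ) : AnalyticAt ℂ (coordRep i j φ) z :=
  ((contMDiffAt_coord hz.2).comp z ((hφ.contMDiffAt (φ.open_source.mem_nhds hz.1)).comp z
    (contMDiff_param i z))).contDiffAt.analyticAt

lemma deriv_coordRep_ne_zero
    (hφ : ContMDiffOn 𝓘(ℂ, Fin 1 → ℂ) 𝓘(ℂ, Fin 1 → ℂ) ω φ φ.source)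
    (hφ' : ContMDiffOn 𝓘(ℂ, Fin 1 → ℂ) 𝓘(ℂ, Fin 1 → ℂ) ω φ.symm φ.target)
    (hz : z ∈ coordDomain i j φ) : deriv (coordRep i j φ) z ≠ 0 := by
  have hrep := (analyticAt_coordRep hφ hz).differentiableAt.hasDerivAt
  have hrep_symm := (analyticAt_coordRep (φ := φ.symm) hφ'
    (coordRep_mem_coordDomain_symm hz)).differentiableAt.hasDerivAt
  have hinv : coordRep j i φ.symm ∘ coordRep i j φ =ᶠ[𝓝 z] id := by
    filter_upwards [(isOpen_coordDomain i j φ).mem_nhds hz] with s hs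
      using coordRep_symm_coordRep hs
  have hmul := (hrep_symm.comp z hrep).unique ((hasDerivAt_id z).congr_of_eventuallyEq hinv)
  exact right_ne_zero_of_mul_eq_one hmul

end Coordinates

section Moebius

lemma smul_homog (g : GL (Fin 2) ℂ) (i : Fin 2) (z : ℂ) (l : Fin 2) :
    (g • homog i fun _ : Fin 1 => z) l = g.1 l (i.succAbove 0) * z + g.1 l i := by
  change ∑ k, g.1 l k * homog i (fun _ => z) k = _
  rw [Fin.sum_univ_succAbove _ i, homog_same, Fin.sum_univ_one, homog,
    Fin.insertNth_apply_succAbove, mul_one, add_comm]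

lemma smul_param_mem_source_iff (g : GL (Fin 2) ℂ) (i j : Fin 2) (z : ℂ) :
    (.mk g : PGL(Fin 2, ℂ)) • param i z ∈ (affineChart j).source ↔
      g.1 j (i.succAbove 0) * z + g.1 j i ≠ 0 := by
  rw [← smul_homog]
  exact mk_mem_affineDomain j _ _

lemma coord_smul_param (g : GL (Fin 2) ℂ) (i j : Fin 2) (z : ℂ) :
    coord j ((.mk g : PGL(Fin 2, ℂ)) • param i z) =
      (g.1 (j.succAbove 0) (i.succAbove 0) * z + g.1 (j.succAbove 0) i) /
        (g.1 j (i.succAbove 0) * z + g.1 j i) := by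
  rw [← smul_homog, ← smul_homog]
  rfl

lemma exists_smul_param_of_moebius (i j : Fin 2) {a b c d : ℂ} (h : a * d - b * c ≠ 0) :
    ∃ g : PGL(Fin 2, ℂ), ∀ z, c * z + d ≠ 0 →
      g • param i z = param j ((a * z + b) / (c * z + d)) := by
  let A : Matrix (Fin 2) (Fin 2) ℂ := fun l k =>
    if l = j then (if k = i then d else c) else (if k = i then b else a)
  have hentries : A j (i.succAbove 0) = c ∧ A j i = d ∧
      A (j.succAbove 0) (i.succAbove 0) = a ∧ A (j.succAbove 0) i = b := by
    simp [A, Fin.succAbove_ne]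
  obtain ⟨hc, hd, ha, hb⟩ := hentries
  have hdet : A.det ≠ 0 := by
    have hminor := det_fin_two_succAbove A i j
    rw [ha, hb, hc, hd] at hminor
    exact right_ne_zero_of_mul (hminor ▸ h)
  refine ⟨.mk (Matrix.GeneralLinearGroup.mkOfDetNeZero A hdet), fun z hz => ?_⟩
  have hmem := (smul_param_mem_source_iff (.mkOfDetNeZero A hdet) i j z).2 (by
    rwa [Matrix.GeneralLinearGroup.val_mkOfDetNeZero, hc, hd])
  rw [← param_coord hmem, coord_smul_param, Matrix.GeneralLinearGroup.val_mkOfDetNeZero, ha, hb, hc,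
    hd]

end Moebius

end CP

section ProjectiveStructuresOnLine

open Filter Set CP

variable {S : Set (OpenPartialHomeomorph (CP 1) (CP 1))}
  {φ ψ : OpenPartialHomeomorph (CP 1) (CP 1)} {i j j' : Fin 2} {z : ℂ}

lemma IsProjStructure.exists_mem_coordDomain (hS : IsProjStructure S) (i : Fin 2) (z : ℂ) :
    ∃ φ ∈ S, ∃ j, z ∈ coordDomain i j φ := by
  have hz : param i z ∈ ⋃ φ ∈ S, φ.source := hS.cover ▸ mem_univ _
  obtain ⟨φ, hφ, hzφ⟩ := mem_iUnion₂.1 hz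
  obtain ⟨j, hj⟩ := exists_mem_affineDomain (φ (param i z))
  exact ⟨φ, hφ, j, hzφ, hj⟩

lemma IsProjStructure.analyticAt_coordRep (hS : IsProjStructure S) (hφ : φ ∈ S)
    (hz : z ∈ coordDomain i j φ) : AnalyticAt ℂ (coordRep i j φ) z :=
  CP.analyticAt_coordRep (hS.holo φ hφ) hz

lemma IsProjStructure.deriv_coordRep_ne_zero (hS : IsProjStructure S) (hφ : φ ∈ S)
    (hz : z ∈ coordDomain i j φ) : deriv (coordRep i j φ) z ≠ 0 :=
  CP.deriv_coordRep_ne_zero (hS.holo φ hφ) (hS.holo_symm φ hφ) hz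

lemma IsProjStructure.eventually_eq_smul {n : ℕ} {S : Set (OpenPartialHomeomorph (CP n) (CP n))}
    (hS : IsProjStructure S) {φ ψ : OpenPartialHomeomorph (CP n) (CP n)}
    (hφ : φ ∈ S) (hψ : ψ ∈ S) {x : CP n} (hx : x ∈ φ.source ∩ ψ.source) :
    ∃ g : PGL(Fin (n + 1), ℂ), ∀ᶠ y in 𝓝 x, φ y = g • ψ y := by
  have : LocallyConnectedSpace (CP n) := ChartedSpace.locallyConnectedSpace (Fin n → ℂ) (CP n)
  obtain ⟨g, hg⟩ := hS.transition φ hφ ψ hψ x hx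
  refine ⟨g, ?_⟩
  filter_upwards [((φ.open_source.inter ψ.open_source).connectedComponentIn (x := x)).mem_nhds
    (mem_connectedComponentIn hx)] with y hy using hg y hy

lemma IsProjStructure.schwarzian_coordRep_eq (hS : IsProjStructure S) (hφ : φ ∈ S) (hψ : ψ ∈ S)
    (hzφ : z ∈ coordDomain i j φ) (hzψ : z ∈ coordDomain i j' ψ) :
    schwarzian (coordRep i j φ) z = schwarzian (coordRep i j' ψ) z := by
  obtain ⟨g, hg⟩ := hS.eventually_eq_smul hφ hψ ⟨hzφ.1, hzψ.1⟩
  obtain ⟨g, rfl⟩ := Matrix.ProjGenLinGroup.mk_surjective g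
  have hdet : g.1.det ≠ 0 := (Matrix.isUnits_det_units g).ne_zero
  have hden : g.1 j (j'.succAbove 0) * coordRep i j' ψ z + g.1 j j' ≠ 0 := by
    rw [← smul_param_mem_source_iff, coordRep, param_coord hzψ.2, ← hg.self_of_nhds]
    exact hzφ.2
  rw [← schwarzian_moebius_comp (hS.analyticAt_coordRep hψ hzψ)
    (hS.deriv_coordRep_ne_zero hψ hzψ) (det_fin_two_succAbove g.1 j' j ▸
      mul_ne_zero (pow_ne_zero _ (neg_ne_zero.2 one_ne_zero)) hdet) hden]
  refine schwarzian_congr ?_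
  filter_upwards [(contMDiff_param i).continuous.continuousAt.eventually hg,
    (isOpen_coordDomain i j' ψ).mem_nhds hzψ] with s hs hsψ
  rw [← coord_smul_param, coordRep, coordRep, param_coord hsψ.2, ← hs]

lemma IsProjStructure.schwarzian_coordRep_eq_inv (hS : IsProjStructure S) (hφ : φ ∈ S)
    (hz0 : z ≠ 0) (hz : z⁻¹ ∈ coordDomain (i.succAbove 0) j φ) :
    schwarzian (coordRep i j φ) z = schwarzian (coordRep (i.succAbove 0) j φ) z⁻¹ * z⁻¹ ^ 4 := by
  rw [← schwarzian_comp_inv hz0 (hS.analyticAt_coordRep hφ hz) (hS.deriv_coordRep_ne_zero hφ hz)]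
  refine schwarzian_congr ?_
  filter_upwards [isOpen_ne.mem_nhds hz0] with s hs
  rw [coordRep, param_eq_param_inv i hs, coordRep]

lemma IsProjStructure.differentiableOn_schwarzian_coordRep (hS : IsProjStructure S) (hφ : φ ∈ S) :
    DifferentiableOn ℂ (schwarzian (coordRep i j φ)) (coordDomain i j φ) := fun _ hz =>
  (analyticAt_schwarzian (hS.analyticAt_coordRep hφ hz)
    (hS.deriv_coordRep_ne_zero hφ hz)).differentiableAt.differentiableWithinAt

lemma IsProjStructure.schwarzian_coordRep_eq_zero (hS : IsProjStructure S) (hφ : φ ∈ S)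
    (hz : z ∈ coordDomain i j φ) : schwarzian (coordRep i j φ) z = 0 := by
  obtain ⟨φ₀, hφ₀, j₀, h0⟩ := hS.exists_mem_coordDomain (i.succAbove 0) 0
  have hinv : Tendsto (fun t : ℂ => t⁻¹) (cocompact ℂ) (𝓝 0) := by
    rw [← Metric.cobounded_eq_cocompact]
    exact tendsto_inv₀_cobounded
  have hmem : ∀ᶠ t in cocompact ℂ, t ≠ 0 ∧ t⁻¹ ∈ coordDomain (i.succAbove 0) j₀ φ₀ :=
    inter_mem (isCompact_singleton (x := (0 : ℂ))).compl_mem_cocompact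
      (hinv.eventually ((isOpen_coordDomain _ _ _).mem_nhds h0))
  have hlim : Tendsto (schwarzian (coordRep i j₀ φ₀)) (cocompact ℂ) (𝓝 0) := by
    have hcont := ((hS.differentiableOn_schwarzian_coordRep hφ₀).continuousOn.continuousAt
      ((isOpen_coordDomain _ _ _).mem_nhds h0)).tendsto
    have hprod := (hcont.comp hinv).mul (hinv.pow 4)
    rw [zero_pow four_ne_zero, mul_zero] at hprod
    refine hprod.congr' ?_
    filter_upwards [hmem] with t ht using (hS.schwarzian_coordRep_eq_inv hφ₀ ht.1 ht.2).symm
  exact eq_zero_of_glue_of_tendsto_cocompact (ι := S × Fin 2)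
    (f := fun k => schwarzian (coordRep i k.2 k.1)) (D := fun k => coordDomain i k.2 k.1)
    (fun _ => isOpen_coordDomain _ _ _)
    (fun t => let ⟨ψ, hψ, j, ht⟩ := hS.exists_mem_coordDomain i t; ⟨(⟨ψ, hψ⟩, j), ht⟩)
    (fun k => hS.differentiableOn_schwarzian_coordRep k.1.2)
    (fun k l _ ht => hS.schwarzian_coordRep_eq k.1.2 l.1.2 ht.1 ht.2) (j := (⟨φ₀, hφ₀⟩, j₀))
    (hmem.mono fun _ ht => (mem_coordDomain_iff_inv_mem ht.1).2 ht.2) hlim (⟨φ, hφ⟩, j) hz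

lemma IsProjStructure.eventually_eq_smul_self (hS : IsProjStructure S) (hφ : φ ∈ S) {x : CP 1}
    (hx : x ∈ φ.source) : ∃ g : PGL(Fin 2, ℂ), ∀ᶠ y in 𝓝 x, φ y = g • y := by
  obtain ⟨i, hi⟩ := exists_mem_affineDomain x
  obtain ⟨j, hj⟩ := exists_mem_affineDomain (φ x)
  have hz : coord i x ∈ coordDomain i j φ := by
    rw [mem_coordDomain, param_coord hi]
    exact ⟨hx, hj⟩
  have hdom := (isOpen_coordDomain i j φ).eventually_mem hz
  obtain ⟨a, b, c, d, hdet, hden, hmoebius⟩ := exists_moebius_of_schwarzian_eq_zero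
    (hS.analyticAt_coordRep hφ hz) (hS.deriv_coordRep_ne_zero hφ hz)
    (hdom.mono fun _ => hS.schwarzian_coordRep_eq_zero hφ)
  have hden_ne : ∀ᶠ s in 𝓝 (coord i x), c * s + d ≠ 0 :=
    ContinuousAt.eventually_ne (by fun_prop) hden
  obtain ⟨g, hg⟩ := exists_smul_param_of_moebius i j hdet
  refine ⟨g, ?_⟩
  filter_upwards [(contMDiffAt_coord hi).continuousAt.eventually
    (hdom.and (hmoebius.and hden_ne)), (affineChart i).open_source.mem_nhds hi] with y hy hyi
  obtain ⟨hydom, hyφ, hyden⟩ := hy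
  rw [← param_coord hyi, hg _ hyden, ← hyφ, coordRep, param_coord hydom.2]

lemma CP.isProjStructure_standard {n : ℕ} : IsProjStructure (standardProjStructure n) where
  cover := by simp [standardProjStructure]
  holo := by
    rintro _ rfl
    exact contMDiffOn_id
  holo_symm := by
    rintro _ rfl
    exact contMDiffOn_id
  transition := by
    rintro _ rfl _ rfl x -
    exact ⟨1, fun y _ => (one_smul _ _).symm⟩

lemma CP.projStructureEquiv_standard (hS : IsProjStructure S) :
    ProjStructureEquiv S (standardProjStructure 1) := by
  have hT := isProjStructure_standard (n := 1)
  have hself {φ : OpenPartialHomeomorph (CP 1) (CP 1)} (hφ : φ ∈ S) {x : CP 1}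
      (hx : x ∈ φ.source) :=
    exists_eq_smul_on_connectedComponentIn φ.open_source
      (fun _ => hS.eventually_eq_smul_self hφ) hx
  refine ⟨?_, ?_, ?_, ?_⟩
  · rw [biUnion_union, hS.cover, univ_union]
  · rintro φ (hφ | hφ)
    exacts [hS.holo φ hφ, hT.holo φ hφ]
  · rintro φ (hφ | hφ)
    exacts [hS.holo_symm φ hφ, hT.holo_symm φ hφ]
  · rintro φ (hφ | hφ) ψ (hψ | hψ) x hx
    · exact hS.transition φ hφ ψ hψ x hx
    · obtain rfl : ψ = OpenPartialHomeomorph.refl (CP 1) := hψ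
      obtain ⟨g, hg⟩ := hself hφ hx.1
      exact ⟨g, fun y hy => hg y (by simpa using hy)⟩
    · obtain rfl : φ = OpenPartialHomeomorph.refl (CP 1) := hφ
      obtain ⟨g, hg⟩ := hself hψ hx.2
      refine ⟨g⁻¹, fun y hy => ?_⟩
      rw [hg y (by simpa using hy), inv_smul_smul]
      rfl
    · exact hT.transition φ hφ ψ hψ x hx

end ProjectiveStructuresOnLine

theorem mainTheorem11 :
    (∀ n : ℕ, 2 ≤ n →
      IsProjConnection (CP.standardProjConnection n) ∧
      IsFlatProjConnection (CP.standardProjConnection n) ∧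
      ∀ S : Set (LocalConn (Fin n → ℂ) (CP n)), IsProjConnection S →
        ProjConnectionEquiv S (CP.standardProjConnection n)) ∧
    (IsProjStructure (CP.standardProjStructure 1) ∧
      ∀ S : Set (OpenPartialHomeomorph (CP 1) (CP 1)), IsProjStructure S →
        ProjStructureEquiv S (CP.standardProjStructure 1)) :=
  ⟨fun _ _ => ⟨CP.isProjConnection_standard, CP.isFlatProjConnection_standard,
    fun _ => CP.projConnectionEquiv_standard⟩,
    CP.isProjStructure_standard, fun _ => CP.projStructureEquiv_standard⟩
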